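/- Conventions. An effective first-order language is one whose symbols carry code numbers such that it is decidable whether a given number codes a function symbol, respectively a relation symbol, of a given arity; sentences then have Gödel numbers, and a set of sentences is $\mathbf d$-computable if the set of Gödel numbers of its members is computable from a set of degree $\mathbf d$. A complete theory in a language $L$ is a consistent set $T$ of $L$-sentences, closed under logical consequence, with $\varphi\in T$ or $\neg\varphi\in T$ for every $L$-sentence $\varphi$. Let $S$ be the first-order language without identity, constant symbols or function symbols, with relation symbols $X^n_i$ $(i\in\mathbb N)$ of each arity $n\ge 0$. For a theory $T$ in $L$, the set $\mathsf V(T)$ of validities of $T$ is the set of those $S$-sentences $\varphi$ such that every $L$-sentence obtained from $\varphi$ by replacing each relation symbol $X^n_i$ by an $L$-formula $\psi^n_i(y_1,\dots,y_n)$, whose free variables are exactly $y_1,\dots,y_n$, is a member of $T$ (bound variables being renamed so that no variable is captured). A PA degree is the Turing degree of a set of natural numbers that computes a complete (consistent) extension of first-order Peano Arithmetic. Theorem. Let $\mathbf d$ be a PA degree. Then there are an effective first-order language $L$ (with identity) and a $\mathbf d$-computable, complete, non-$\aleph_0$-categorical theory $T$ in $L$ with infinite models such that $\mathsf V(T)$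 is also $\mathbf d$-computable. -/

import Mathlib

namespace Validities

open FirstOrder FirstOrder.Language

/-! ### Effective languages and Gödel numbers of sentences -/

/-- An effective presentation of a first-order language: the function symbols and the relation
symbols of each arity carry distinct code numbers, and it is decidable whether a number codes a
symbol of a given arity. -/
structure EffectiveLanguage (L : FirstOrder.Language.{0, 0}) where
  funCode : ∀ {n : ℕ}, L.Functions n → ℕ
  relCode : ∀ {n : ℕ}, L.Relations n → ℕ
  funCode_injective : ∀ n : ℕ, Function.Injective (funCode (n := n))
  relCode_injective : ∀ n : ℕ, Function.Injective (relCode (n := n))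
  funCode_computable :
    ComputablePred fun p : ℕ × ℕ => ∃ f : L.Functions p.1, funCode f = p.2
  relCode_computable :
    ComputablePred fun p : ℕ × ℕ => ∃ R : L.Relations p.1, relCode R = p.2

variable {L : FirstOrder.Language.{0, 0}}

/-- Gödel number of a term whose variables are the (de Bruijn) variables `0, …, n - 1`. -/
def EffectiveLanguage.termCode (ν : EffectiveLanguage L) {n : ℕ} :
    L.Term (Empty ⊕ Fin n) → ℕ
  | .var (.inl e) => e.elim
  | .var (.inr i) => Nat.pair 0 i
  | @Term.func _ _ l f ts =>
      Nat.pair 1 (Nat.pair (Nat.pair l (ν.funCode f))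
        (Encodable.encode (List.ofFn fun i => ν.termCode (ts i))))

/-- Gödel number of a formula whose free variables are among `0, …, n - 1`. -/
def EffectiveLanguage.formulaCode (ν : EffectiveLanguage L) :
    ∀ {n : ℕ}, L.BoundedFormula Empty n → ℕ
  | _, .falsum => Nat.pair 0 0
  | _, .equal t₁ t₂ => Nat.pair 1 (Nat.pair (ν.termCode t₁) (ν.termCode t₂))
  | _, @BoundedFormula.rel _ _ _ l R ts =>
      Nat.pair 2 (Nat.pair (Nat.pair l (ν.relCode R))
        (Encodable.encode (List.ofFn fun i => ν.termCode (ts i))))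
  | _, .imp φ₁ φ₂ => Nat.pair 3 (Nat.pair (ν.formulaCode φ₁) (ν.formulaCode φ₂))
  | _, .all φ => Nat.pair 4 (ν.formulaCode φ)

/-- The set of Gödel numbers of the members of a set of sentences. -/
def EffectiveLanguage.codes (ν : EffectiveLanguage L) (T : Set L.Sentence) : Set ℕ :=
  {m | ∃ φ ∈ T, ν.formulaCode φ = m}

/-! ### Theories -/

/-- A complete theory: a consistent set of sentences that is closed under logical consequence
and decides every sentence. -/
def IsCompleteTheory (T : L.Theory) : Prop :=
  (∀ φ : L.Sentence, T ⊨ᵇ φ → φ ∈ T) ∧ T.IsComplete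

/-! ### The schematic language and the validities of a theory -/

/-- The schematic language: no function or constant symbols, and countably many relation symbols
`X^n_i` (`i : ℕ`) of each arity `n ≥ 0`. -/
def schematic : FirstOrder.Language.{0, 0} where
  Functions := fun _ => Empty
  Relations := fun _ => ℕ

/-- The standard numbering of the schematic language: the symbol `X^n_i` has code `i`. -/
def schematicEffective : EffectiveLanguage schematic where
  funCode := fun {_} f => Empty.elim f
  relCode := fun {_} i => i
  funCode_injective := fun _ f => Empty.elim f
  relCode_injective := fun _ _ _ h => h
  funCode_computable := by
    refine ComputablePred.of_eq (p := fun _ => False) ⟨fun _ => isFalse id, ?_⟩ ?_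
    · exact (Computable.const false).of_eq fun _ => by simp
    · rintro ⟨n, c⟩
      simp only [false_iff]
      rintro ⟨f, -⟩
      exact Empty.elim f
  relCode_computable := by
    refine ComputablePred.of_eq (p := fun _ => True) ⟨fun _ => isTrue trivial, ?_⟩ ?_
    · exact (Computable.const true).of_eq fun _ => by simp
    · rintro ⟨n, c⟩
      exact ⟨fun _ => ⟨c, rfl⟩, fun _ => trivial⟩

/-- The formula does not contain the identity symbol. -/
def EqualityFree {L' : FirstOrder.Language.{0, 0}} {α : Type} :
    ∀ {n : ℕ}, L'.BoundedFormula α n → Prop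
  | _, .falsum => True
  | _, .equal _ _ => False
  | _, .rel _ _ => True
  | _, .imp φ₁ φ₂ => EqualityFree φ₁ ∧ EqualityFree φ₂
  | _, .all φ => EqualityFree φ

/-- A term of the schematic language is a variable; this is that variable. -/
def termVar {α : Type} : schematic.Term α → α
  | .var a => a
  | .func f _ => Empty.elim f

/-- Replace in a schematic formula each atomic formula `X^l_i t₁ … t_l` by
`ψ^l_i(t₁, …, t_l)`, where `ψ^l_i` is the formula `ψ l i` of `L`. -/
def substitute (ψ : ∀ l : ℕ, ℕ → L.Formula (Fin l)) :
    ∀ {n : ℕ}, schematic.BoundedFormula Empty n → L.BoundedFormula Empty n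
  | _, .falsum => .falsum
  | _, .equal t₁ t₂ => .equal (.var (termVar t₁)) (.var (termVar t₂))
  | _, @BoundedFormula.rel _ _ _ l i ts =>
      BoundedFormula.relabel (fun j => termVar (ts j)) (ψ l i)
  | _, .imp φ₁ φ₂ => .imp (substitute ψ φ₁) (substitute ψ φ₂)
  | _, .all φ => .all (substitute ψ φ)

/-- The validities of a theory `T`: the identity-free sentences `φ` of the schematic language all
of whose substitution instances belong to `T`, where for `X^l_i` one substitutes a formula of `L`
whose free variables are exactly the `l` displayed ones. -/
def validities (T : L.Theory) : Set schematic.Sentence :=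
  {φ | EqualityFree φ ∧
    ∀ ψ : ∀ l : ℕ, ℕ → L.Formula (Fin l),
      (∀ (l i : ℕ) (j : Fin l), j ∈ (ψ l i).freeVarFinset) →
        (substitute ψ φ : L.Sentence) ∈ T}

/-! ### Peano Arithmetic -/

/-- The function symbols of arithmetic. -/
inductive ArithFunctions : ℕ → Type
  | zero : ArithFunctions 0
  | succ : ArithFunctions 1
  | add : ArithFunctions 2
  | mul : ArithFunctions 2

/-- The first-order language of arithmetic `0, S, +, ·` (with identity). -/
def arith : FirstOrder.Language.{0, 0} where
  Functions := ArithFunctions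
  Relations := fun _ => Empty

/-- The code number of a symbol of arithmetic. -/
def arithFunCode : ∀ {n : ℕ}, ArithFunctions n → ℕ
  | _, .zero => 0
  | _, .succ => 1
  | _, .add => 2
  | _, .mul => 3

/-- The standard numbering of the language of arithmetic. -/
def arithEffective : EffectiveLanguage arith where
  funCode := fun {_} f => arithFunCode f
  relCode := fun {_} R => Empty.elim R
  funCode_injective := by
    intro n f g h
    cases f <;> cases g <;> first | rfl | exact absurd h (by simp [arithFunCode])
  relCode_injective := fun _ R => Empty.elim R
  funCode_computable := by
    refine ComputablePred.of_eq
      (p := fun p : ℕ × ℕ => p = (0, 0) ∨ p = (1, 1) ∨ p = (2, 2) ∨ p = (2, 3)) ?_ ?_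
    · refine ⟨inferInstance, Primrec.to_comp ?_⟩
      have h : ∀ c : ℕ × ℕ, PrimrecPred fun p : ℕ × ℕ => p = c := fun c =>
        PrimrecRel.comp Primrec.eq Primrec.id (Primrec.const c)
      exact ((h _).or ((h _).or ((h _).or (h _)))).decide.of_eq fun _ => by
        congr
    · rintro ⟨n, c⟩
      constructor
      · rintro (h | h | h | h) <;> obtain ⟨rfl, rfl⟩ := Prod.mk.inj h
        · exact ⟨.zero, rfl⟩
        · exact ⟨.succ, rfl⟩
        · exact ⟨.add, rfl⟩
        · exact ⟨.mul, rfl⟩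
      · rintro ⟨f, hf⟩
        change ArithFunctions n at f
        replace hf : arithFunCode f = c := hf
        subst hf
        cases f <;> simp [arithFunCode]
  relCode_computable := by
    refine ComputablePred.of_eq (p := fun _ => False) ⟨fun _ => isFalse id, ?_⟩ ?_
    · exact (Computable.const false).of_eq fun _ => by simp
    · rintro ⟨n, c⟩
      simp only [false_iff]
      rintro ⟨R, -⟩
      exact Empty.elim R

/-- The term `0`. -/
def tZero {α : Type} : arith.Term α := .func ArithFunctions.zero ![]

/-- The term `S t`. -/
def tSucc {α : Type} (t : arith.Term α) : arith.Term α := .func ArithFunctions.succ ![t]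

/-- The term `s + t`. -/
def tAdd {α : Type} (s t : arith.Term α) : arith.Term α := .func ArithFunctions.add ![s, t]

/-- The term `s · t`. -/
def tMul {α : Type} (s t : arith.Term α) : arith.Term α := .func ArithFunctions.mul ![s, t]

/-- The `i`-th bound variable. -/
def bv {n : ℕ} (i : Fin n) : arith.Term (Empty ⊕ Fin n) := .var (.inr i)

/-- Turn the free variables `0, …, n - 1` of a formula into bound variables. -/
def bindVars {n : ℕ} (φ : arith.Formula (Fin n)) : arith.BoundedFormula Empty n :=
  BoundedFormula.relabel (n := n) Sum.inr φ

/-- The universal closure of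
`φ(x̄, 0) → ∀ y (φ(x̄, y) → φ(x̄, S y)) → ∀ y φ(x̄, y)`, where `x̄` are the first `n` variables
of `φ` and `y` is the last one. -/
def inductionAxiom {n : ℕ} (φ : arith.Formula (Fin (n + 1))) : arith.Sentence :=
  let base : arith.Formula (Fin n) :=
    BoundedFormula.subst φ (Fin.snoc (α := fun _ => arith.Term (Fin n)) Term.var tZero)
  let step : arith.Formula (Fin (n + 1)) :=
    BoundedFormula.subst φ (Fin.snoc (α := fun _ => arith.Term (Fin (n + 1)))
      (fun i => Term.var i.castSucc) (tSucc (Term.var (Fin.last n))))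
  ((bindVars base).imp (((bindVars φ).imp (bindVars step)).all.imp (bindVars φ).all)).alls

/-- The axioms of first-order Peano Arithmetic. -/
inductive PA : arith.Theory
  /-- `∀ x, S x ≠ 0` -/
  | succ_ne_zero :
      PA (BoundedFormula.all (n := 0) (Term.bdEqual (tSucc (bv 0)) tZero).not)
  /-- `∀ x y, S x = S y → x = y` -/
  | succ_inj :
      PA (BoundedFormula.all (n := 0) (BoundedFormula.all
        ((Term.bdEqual (tSucc (bv 0)) (tSucc (bv 1))).imp (Term.bdEqual (bv 0) (bv 1)))))
  /-- `∀ x, x + 0 = x` -/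
  | add_zero :
      PA (BoundedFormula.all (n := 0) (Term.bdEqual (tAdd (bv 0) tZero) (bv 0)))
  /-- `∀ x y, x + S y = S (x + y)` -/
  | add_succ :
      PA (BoundedFormula.all (n := 0) (BoundedFormula.all
        (Term.bdEqual (tAdd (bv 0) (tSucc (bv 1))) (tSucc (tAdd (bv 0) (bv 1))))))
  /-- `∀ x, x · 0 = 0` -/
  | mul_zero :
      PA (BoundedFormula.all (n := 0) (Term.bdEqual (tMul (bv 0) tZero) tZero))
  /-- `∀ x y, x · S y = x · y + x` -/
  | mul_succ :
      PA (BoundedFormula.all (n := 0) (BoundedFormula.all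
        (Term.bdEqual (tMul (bv 0) (tSucc (bv 1))) (tAdd (tMul (bv 0) (bv 1)) (bv 0)))))
  /-- the induction scheme, with parameters -/
  | induction {n : ℕ} (φ : arith.Formula (Fin (n + 1))) : PA (inductionAxiom φ)

/-! ### Turing degrees of sets and PA degrees -/

open Classical in
/-- The characteristic function of a set of natural numbers. -/
noncomputable def charFun (A : Set ℕ) : ℕ → ℕ := fun n => if n ∈ A then 1 else 0

/-- The Turing degree of a set of natural numbers. -/
noncomputable def degree (A : Set ℕ) : TuringDegree :=
  toAntisymmetrization TuringReducible (charFun A : ℕ →. ℕ)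

/-- The set `A` is `d`-computable. -/
def ComputableInDegree (d : TuringDegree) (A : Set ℕ) : Prop := degree A ≤ d

/-- A PA degree: the degree of a set of natural numbers that computes a complete (consistent)
extension of first-order Peano Arithmetic. -/
def IsPADegree (d : TuringDegree) : Prop :=
  (∃ A : Set ℕ, d = degree A) ∧
    ∃ U : arith.Theory, PA ⊆ U ∧ IsCompleteTheory U ∧
      ComputableInDegree d (arithEffective.codes U)

end Validities

/-! A complete extension of PA computes a member of every nonempty effectively closed class of
binary sequences (`exists_member_turingReducible`). So it is enough to find one such class, each
member of which encodes both a suitable theory and its validities.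

Take L to be the schematic language itself, now with identity. A member of the class (`Coherent`) is
the diagram of a structure on the natural numbers: its atomic facts, its satisfaction relation,
satisfaction after formulas are substituted for symbols, and a set declared to be the validities.
Closedness is threatened at two points. A false universal formula must have a counterexample, and
this is required below an explicit bound, so that the requirement is a finite disjunction. A
sentence that is not valid must have a false instance, and this instance is prescribed: its symbols
are renamed into a copy of the vocabulary indexed by its own Gödel number. The theory of the
structure and its validities are then both read off primitive recursively (`codes_diagramTheory`,
`codes_validities`). On the element 2k certain unary predicates spell the binary digits of k. Hence
every finite pattern of these predicates occurs, an ultrapower realises uncountably many types, and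
the theory is not categorical in the countable cardinality (`not_categorical_of_patterns`).

The class is nonempty (`exists_coherent`) because of an ultraproduct of finite structures on {0, …,
k}. A finite structure refuting an identity-free sentence can be blown up to every larger size by
duplicating an element, so all these counterexamples can be placed at once in disjoint copies of the
vocabulary. Sentences true in all finite structures stay true in the limit under every definable
interpretation, by Łoś's theorem. So in the limit the validities are exactly the identity-free
sentences true in all finite structures, and each other identity-free sentence fails in its
prescribed instance. Countably many elements are then named by numbers, with witnesses named in
time.

A member of the class is computed by following a binary tree and never entering a dead branch when
the other one is alive. Which branch dies is a question about two primitive recursive searches, and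
a Rosser sentence decides it (`exists_primrec_separating`). The member so obtained need not describe
the limit structure; coherence alone gives all that is claimed. -/

namespace Validities

open FirstOrder FirstOrder.Language

/-! ### Models of arithmetic -/

section ArithModels

variable {M : Type} [arith.Structure M]

/-- The interpretation of `0`. -/
def mZero (M : Type) [arith.Structure M] : M :=
  Structure.funMap (L := arith) ArithFunctions.zero ![]

/-- The interpretation of the successor. -/
def mSucc (a : M) : M := Structure.funMap (L := arith) ArithFunctions.succ ![a]

/-- The interpretation of addition. -/
def mAdd (a b : M) : M := Structure.funMap (L := arith) ArithFunctions.add ![a, b]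

/-- The interpretation of multiplication. -/
def mMul (a b : M) : M := Structure.funMap (L := arith) ArithFunctions.mul ![a, b]

/-- The interpretation of the numeral of a natural number. -/
def num (M : Type) [arith.Structure M] : ℕ → M
  | 0 => mZero M
  | n + 1 => mSucc (num M n)

@[simp] lemma realize_tZero {α : Type} (v : α → M) : (tZero : arith.Term α).realize v = mZero M := by
  simp only [tZero, Term.realize, mZero]
  congr 1
  exact Subsingleton.elim _ _

@[simp] lemma realize_tSucc {α : Type} (v : α → M) (t : arith.Term α) :
    (tSucc t).realize v = mSucc (t.realize v) := by
  simp only [tSucc, Term.realize, mSucc]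
  congr 1
  funext i
  fin_cases i
  rfl

@[simp] lemma realize_tAdd {α : Type} (v : α → M) (s t : arith.Term α) :
    (tAdd s t).realize v = mAdd (s.realize v) (t.realize v) := by
  simp only [tAdd, Term.realize, mAdd]
  congr 1
  funext i
  fin_cases i <;> rfl

@[simp] lemma realize_tMul {α : Type} (v : α → M) (s t : arith.Term α) :
    (tMul s t).realize v = mMul (s.realize v) (t.realize v) := by
  simp only [tMul, Term.realize, mMul]
  congr 1
  funext i
  fin_cases i <;> rfl

lemma mSucc_ne_mZero (hM : M ⊨ PA) (a : M) : mSucc a ≠ mZero M := by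
  have h := hM.realize_of_mem _ PA.succ_ne_zero
  simp only [Sentence.Realize, Formula.Realize, BoundedFormula.realize_all,
    BoundedFormula.realize_not, BoundedFormula.realize_bdEqual, realize_tSucc, realize_tZero, bv,
    Term.realize_var] at h
  exact h a

lemma mSucc_inj (hM : M ⊨ PA) {a b : M} (hab : mSucc a = mSucc b) : a = b := by
  have h := hM.realize_of_mem _ PA.succ_inj
  simp only [Sentence.Realize, Formula.Realize, BoundedFormula.realize_all,
    BoundedFormula.realize_imp, BoundedFormula.realize_bdEqual, realize_tSucc, bv,
    Term.realize_var] at h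
  exact h a b hab

lemma mAdd_mZero (hM : M ⊨ PA) (a : M) : mAdd a (mZero M) = a := by
  have h := hM.realize_of_mem _ PA.add_zero
  simp only [Sentence.Realize, Formula.Realize, BoundedFormula.realize_all,
    BoundedFormula.realize_bdEqual, realize_tAdd, realize_tZero, bv, Term.realize_var] at h
  exact h a

lemma mAdd_mSucc (hM : M ⊨ PA) (a b : M) : mAdd a (mSucc b) = mSucc (mAdd a b) := by
  have h := hM.realize_of_mem _ PA.add_succ
  simp only [Sentence.Realize, Formula.Realize, BoundedFormula.realize_all,
    BoundedFormula.realize_bdEqual, realize_tAdd, realize_tSucc, bv, Term.realize_var] at h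
  exact h a b

lemma mMul_mZero (hM : M ⊨ PA) (a : M) : mMul a (mZero M) = mZero M := by
  have h := hM.realize_of_mem _ PA.mul_zero
  simp only [Sentence.Realize, Formula.Realize, BoundedFormula.realize_all,
    BoundedFormula.realize_bdEqual, realize_tMul, realize_tZero, bv, Term.realize_var] at h
  exact h a

lemma mMul_mSucc (hM : M ⊨ PA) (a b : M) : mMul a (mSucc b) = mAdd (mMul a b) a := by
  have h := hM.realize_of_mem _ PA.mul_succ
  simp only [Sentence.Realize, Formula.Realize, BoundedFormula.realize_all,
    BoundedFormula.realize_bdEqual, realize_tMul, realize_tSucc, realize_tAdd, bv,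
    Term.realize_var] at h
  exact h a b

/-- The formula `y = 0 ∨ ∃ z, y = S z`. -/
def zeroOrSucc : arith.Formula (Fin 1) :=
  (Term.bdEqual (n := 0) (.var (.inl 0)) tZero) ⊔
    (Term.bdEqual (n := 1) (.var (.inl 0)) (tSucc (.var (.inr 0)))).ex

lemma realize_zeroOrSucc {v : Fin 1 → M} {xs : Fin 0 → M} :
    BoundedFormula.Realize zeroOrSucc v xs ↔ v 0 = mZero M ∨ ∃ z, v 0 = mSucc z := by
  simp [zeroOrSucc, BoundedFormula.realize_sup, BoundedFormula.realize_ex, Fin.snoc]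

/-- This is the only use of the induction scheme. Everything else about models is drawn from the
recursion equations and this fact, that is, from Robinson arithmetic. -/
lemma eq_mZero_or_mSucc (hM : M ⊨ PA) (a : M) : a = mZero M ∨ ∃ b, a = mSucc b := by
  have h := hM.realize_of_mem _ (PA.induction zeroOrSucc)
  have h' : BoundedFormula.Realize (M := M) (inductionAxiom (n := 0) zeroOrSucc) default default := h
  unfold inductionAxiom at h'
  simp only [BoundedFormula.alls, BoundedFormula.realize_imp, BoundedFormula.realize_all,
    bindVars, BoundedFormula.realize_relabel, BoundedFormula.realize_subst] at h'
  exact realize_zeroOrSucc.1 (h' (realize_zeroOrSucc.2 (.inl (realize_tZero _)))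
    (fun b _ => realize_zeroOrSucc.2 (.inr ⟨b, realize_tSucc _ _⟩)) a)

lemma mAdd_num (hM : M ⊨ PA) (m n : ℕ) : mAdd (num M m) (num M n) = num M (m + n) := by
  induction n with
  | zero => exact mAdd_mZero hM _
  | succ n ih => rw [num, mAdd_mSucc hM, ih]; rfl

lemma mMul_num (hM : M ⊨ PA) (m n : ℕ) : mMul (num M m) (num M n) = num M (m * n) := by
  induction n with
  | zero => exact mMul_mZero hM _
  | succ n ih => rw [num, mMul_mSucc hM, ih, mAdd_num hM, Nat.mul_succ]

lemma num_injective (hM : M ⊨ PA) : Function.Injective (num M) := by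
  intro m n h
  induction m generalizing n with
  | zero => cases n with
    | zero => rfl
    | succ n => exact absurd h.symm (mSucc_ne_mZero hM _)
  | succ m ih => cases n with
    | zero => exact absurd h (mSucc_ne_mZero hM _)
    | succ n => rw [ih (mSucc_inj hM h)]

/-- The order of a model of arithmetic. -/
def mLe (a b : M) : Prop := ∃ c, mAdd c a = b

/-- The difference is the left summand, so the recursion equations strip successors from `a` and
from the numeral simultaneously. After at most `k` steps `a` is exhausted, and commutativity of
addition is never needed. -/
lemma mLe_num_iff (hM : M ⊨ PA) {a : M} {k : ℕ} : mLe a (num M k) ↔ ∃ j ≤ k, a = num M j := by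
  constructor
  · rintro ⟨c, hc⟩
    induction k generalizing a with
    | zero =>
      rcases eq_mZero_or_mSucc hM a with rfl | ⟨b, rfl⟩
      · exact ⟨0, le_rfl, rfl⟩
      · rw [mAdd_mSucc hM] at hc
        exact absurd hc (mSucc_ne_mZero hM _)
    | succ k ih =>
      rcases eq_mZero_or_mSucc hM a with rfl | ⟨b, rfl⟩
      · exact ⟨0, Nat.zero_le _, rfl⟩
      · rw [mAdd_mSucc hM] at hc
        obtain ⟨j, hj, rfl⟩ := ih (mSucc_inj hM hc)
        exact ⟨j + 1, by omega, rfl⟩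
  · rintro ⟨j, hj, rfl⟩
    exact ⟨num M (k - j), by rw [mAdd_num hM, Nat.sub_add_cancel hj]⟩

lemma mLe_num_num (hM : M ⊨ PA) {j k : ℕ} : mLe (num M j) (num M k) ↔ j ≤ k := by
  rw [mLe_num_iff hM]
  constructor
  · rintro ⟨i, hi, h⟩
    rwa [num_injective hM h]
  · exact fun h => ⟨j, h, rfl⟩

/-- One side is a numeral, so induction outside the model suffices. It serves to compare a possibly
nonstandard witness with a standard one. -/
lemma mLe_total_num (hM : M ⊨ PA) (a : M) (k : ℕ) : mLe a (num M k) ∨ mLe (num M k) a := by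
  induction k generalizing a with
  | zero => exact .inr ⟨a, mAdd_mZero hM a⟩
  | succ k ih =>
    rcases eq_mZero_or_mSucc hM a with rfl | ⟨b, rfl⟩
    · exact .inl ⟨_, mAdd_mZero hM _⟩
    · rcases ih b with ⟨c, h⟩ | ⟨c, h⟩
      · exact .inl ⟨c, by rw [mAdd_mSucc hM, h]; rfl⟩
      · exact .inr ⟨c, by rw [num, mAdd_mSucc hM, h]⟩

end ArithModels

/-! ### Uniformly definable predicates -/

/-- A predicate on all structures for arithmetic that is defined by one formula. -/
def UDef {α : Type} (P : ∀ (M : Type) [arith.Structure M], (α → M) → Prop) : Prop :=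
  ∃ φ : arith.Formula α, ∀ (M : Type) [arith.Structure M] (v : α → M), φ.Realize v ↔ P M v

namespace UDef

variable {α β : Type} {P Q : ∀ (M : Type) [arith.Structure M], (α → M) → Prop}

lemma not (hP : UDef P) : UDef fun M _ v => ¬ P M v := by
  obtain ⟨φ, hφ⟩ := hP
  exact ⟨φ.not, fun M _ v => by rw [Formula.realize_not, hφ]⟩

lemma imp (hP : UDef P) (hQ : UDef Q) : UDef fun M _ v => P M v → Q M v := by
  obtain ⟨φ, hφ⟩ := hP
  obtain ⟨ψ, hψ⟩ := hQ
  exact ⟨φ.imp ψ, fun M _ v => by rw [Formula.realize_imp, hφ, hψ]⟩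

lemma and (hP : UDef P) (hQ : UDef Q) : UDef fun M _ v => P M v ∧ Q M v := by
  obtain ⟨φ, hφ⟩ := hP
  obtain ⟨ψ, hψ⟩ := hQ
  exact ⟨φ ⊓ ψ, fun M _ v => by rw [Formula.realize_inf, hφ, hψ]⟩

lemma comp (hP : UDef P) (g : α → β) : UDef fun M _ v => P M fun a => v (g a) := by
  obtain ⟨φ, hφ⟩ := hP
  exact ⟨φ.relabel g, fun M _ v => by rw [Formula.realize_relabel, hφ]; rfl⟩

lemma eq (s t : arith.Term α) : UDef fun _ _ v => s.realize v = t.realize v :=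
  ⟨s.equal t, fun M _ v => by rw [Formula.realize_equal]⟩

/-- The extra coordinate `Fin 1` carries the quantified variable, which relabelling turns from a
free into a bound one. -/
lemma ex {P : ∀ (M : Type) [arith.Structure M], (α ⊕ Fin 1 → M) → Prop} (hP : UDef P) :
    UDef fun M _ v => ∃ y : M, P M (Sum.elim v fun _ => y) := by
  obtain ⟨φ, hφ⟩ := hP
  refine ⟨(BoundedFormula.relabel (n := 1) (k := 0) id φ : arith.BoundedFormula α 1).ex,
    fun M _ v => ?_⟩
  simp only [Formula.Realize, BoundedFormula.realize_ex, BoundedFormula.realize_relabel]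
  refine exists_congr fun y => ?_
  rw [← hφ, Formula.Realize,
    Subsingleton.elim (α := Fin 0 → M) (Fin.snoc default y ∘ Fin.natAdd 1) default]
  have : (Sum.elim v (Fin.snoc default y ∘ Fin.castAdd 0) ∘ id : α ⊕ Fin 1 → M)
      = Sum.elim v fun _ => y := by
    funext a
    rcases a with a | i
    · rfl
    · fin_cases i; rfl
  exact iff_of_eq (congrArg (fun w => BoundedFormula.Realize φ w default) this)

lemma all {P : ∀ (M : Type) [arith.Structure M], (α ⊕ Fin 1 → M) → Prop} (hP : UDef P) :
    UDef fun M _ v => ∀ y : M, P M (Sum.elim v fun _ => y) := by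
  obtain ⟨φ, hφ⟩ := hP.not.ex.not
  exact ⟨φ, fun M _ v => (hφ M v).trans not_exists_not⟩

lemma le (a b : α) : UDef fun _ _ v => mLe (v a) (v b) := by
  obtain ⟨φ, hφ⟩ := (UDef.eq (tAdd (.var (.inr 0)) (.var (.inl a)) : arith.Term (α ⊕ Fin 1))
    (.var (.inl b))).ex
  refine ⟨φ, fun M _ v => ?_⟩
  rw [hφ]
  simp [mLe]

end UDef

/-! ### Numeralwise representable relations and functions -/

/-- The relation is decided at numerals, by one formula, in all models of Peano Arithmetic. -/
def RepRel {α : Type} (R : (α → ℕ) → Prop) : Prop :=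
  ∃ P : ∀ (M : Type) [arith.Structure M], (α → M) → Prop, UDef P ∧
    ∀ (M : Type) [arith.Structure M], M ⊨ PA → ∀ v : α → ℕ, P M (fun a => num M (v a)) ↔ R v

/-- The graph of the function is defined at numerals, by one formula, in all models of
Peano Arithmetic. -/
def RepFun {α : Type} (f : (α → ℕ) → ℕ) : Prop :=
  ∃ Q : ∀ (M : Type) [arith.Structure M], (α → M) → M → Prop,
    (UDef fun M _ (u : α ⊕ Fin 1 → M) => Q M (fun a => u (.inl a)) (u (.inr 0))) ∧
    ∀ (M : Type) [arith.Structure M], M ⊨ PA → ∀ (v : α → ℕ) (y : M),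
      Q M (fun a => num M (v a)) y ↔ y = num M (f v)

section Rep

variable {α β : Type} {R R' : (α → ℕ) → Prop} {f g : (α → ℕ) → ℕ}

lemma RepRel.of_iff (hR : RepRel R) (h : ∀ v, R v ↔ R' v) : RepRel R' :=
  (funext fun v => propext (h v) : R = R') ▸ hR

lemma RepFun.of_eq (hf : RepFun f) (h : ∀ v, f v = g v) : RepFun g :=
  (funext h : f = g) ▸ hf

lemma RepRel.not (hR : RepRel R) : RepRel fun v => ¬ R v := by
  obtain ⟨P, hP, h⟩ := hR
  exact ⟨_, hP.not, fun M _ hM v => by rw [h M hM]⟩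

lemma RepRel.imp (hR : RepRel R) (hR' : RepRel R') : RepRel fun v => R v → R' v := by
  obtain ⟨P, hP, h⟩ := hR
  obtain ⟨P', hP', h'⟩ := hR'
  exact ⟨_, hP.imp hP', fun M _ hM v => by rw [h M hM, h' M hM]⟩

lemma RepRel.and (hR : RepRel R) (hR' : RepRel R') : RepRel fun v => R v ∧ R' v :=
  (hR.imp hR'.not).not.of_iff fun v => by tauto

lemma RepRel.or (hR : RepRel R) (hR' : RepRel R') : RepRel fun v => R v ∨ R' v :=
  (hR.not.imp hR').of_iff fun v => by tauto

lemma RepFun.relabel (hf : RepFun f) (g : α → β) : RepFun fun v : β → ℕ => f fun a => v (g a) := by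
  obtain ⟨Q, hQ, h⟩ := hf
  exact ⟨fun M _ v y => Q M (fun a => v (g a)) y,
    hQ.comp (Sum.elim (fun a => Sum.inl (g a)) fun _ => Sum.inr 0),
    fun M _ hM v => h M hM fun a => v (g a)⟩

/-- Substitute a representable function for a variable of a representable relation. -/
lemma RepRel.subst {R : (α → ℕ) → ℕ → Prop}
    (hR : RepRel fun u : α ⊕ Fin 1 → ℕ => R (fun a => u (.inl a)) (u (.inr 0))) (hf : RepFun f) :
    RepRel fun v => R v (f v) := by
  obtain ⟨P, hP, h⟩ := hR
  obtain ⟨Q, hQ, h'⟩ := hf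
  refine ⟨_, (hQ.and hP).ex, fun M _ hM v => ?_⟩
  have e : (Sum.elim (fun a => num M (v a)) fun _ => num M (f v) : α ⊕ Fin 1 → M) =
      fun a => num M (Sum.elim v (fun _ => f v) a) := by
    funext a
    rcases a with a | a <;> rfl
  constructor
  · rintro ⟨y, hy, hy'⟩
    -- The graph formula pins down `y` among all elements of the model, nonstandard ones included,
    -- so no spurious value can satisfy `P`.
    obtain rfl := (h' M hM v y).1 hy
    rw [e] at hy'
    exact (h M hM _).1 hy'
  · intro hv
    refine ⟨num M (f v), (h' M hM v _).2 rfl, ?_⟩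
    rw [e]
    exact (h M hM _).2 hv

lemma RepFun.proj (a : α) : RepFun fun v => v a :=
  ⟨fun _ _ v y => y = v a, UDef.eq (.var (.inr 0) : arith.Term (α ⊕ Fin 1)) (.var (.inl a)), fun _ _ _ _ _ => Iff.rfl⟩

lemma RepFun.zero : RepFun fun _ : α → ℕ => 0 := by
  refine ⟨fun M _ _ y => y = mZero M, ?_, fun _ _ _ _ _ => Iff.rfl⟩
  obtain ⟨φ, hφ⟩ := UDef.eq (.var (.inr 0) : arith.Term (α ⊕ Fin 1)) tZero
  exact ⟨φ, fun M _ v => (hφ M v).trans (by simp)⟩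

lemma RepFun.succ (hf : RepFun f) : RepFun fun v => f v + 1 := by
  obtain ⟨Q, hQ, h⟩ := hf
  refine ⟨fun M _ v y => ∃ a, Q M v a ∧ y = mSucc a, ?_, fun M _ hM v y => ?_⟩
  · obtain ⟨φ, hφ⟩ := ((hQ.comp (Sum.elim (fun a => Sum.inl (Sum.inl a)) fun _ => Sum.inr 0)).and
      (UDef.eq (.var (.inl (.inr 0)) : arith.Term ((α ⊕ Fin 1) ⊕ Fin 1))
        (tSucc (.var (.inr 0))))).ex
    exact ⟨φ, fun M _ v => (hφ M v).trans (by simp)⟩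
  · simp only [h M hM, exists_eq_left]; rfl

lemma RepFun.const (n : ℕ) : RepFun fun _ : α → ℕ => n := by
  induction n with
  | zero => exact .zero
  | succ n ih => exact ih.succ

lemma RepFun.add (hf : RepFun f) (hg : RepFun g) : RepFun fun v => f v + g v := by
  obtain ⟨Q, hQ, h⟩ := hf
  obtain ⟨Q', hQ', h'⟩ := hg
  refine ⟨fun M _ v y => ∃ a b, (Q M v a ∧ Q' M v b) ∧ y = mAdd a b, ?_, fun M _ hM v y => ?_⟩
  · obtain ⟨φ, hφ⟩ := (((hQ.comp (Sum.elim (fun a => .inl (.inl (.inl a))) fun _ => .inl (.inr 0))).and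
      (hQ'.comp (Sum.elim (fun a => .inl (.inl (.inl a))) fun _ => .inr 0))).and
      (UDef.eq (.var (.inl (.inl (.inr 0))) : arith.Term (((α ⊕ Fin 1) ⊕ Fin 1) ⊕ Fin 1))
        (tAdd (.var (.inl (.inr 0))) (.var (.inr 0))))).ex.ex
    exact ⟨φ, fun M _ v => (hφ M v).trans (by simp)⟩
  · simp only [h M hM, h' M hM, ← mAdd_num hM]
    constructor
    · rintro ⟨a, b, ⟨rfl, rfl⟩, h⟩; exact h
    · exact fun h => ⟨_, _, ⟨rfl, rfl⟩, h⟩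

lemma RepFun.mul (hf : RepFun f) (hg : RepFun g) : RepFun fun v => f v * g v := by
  obtain ⟨Q, hQ, h⟩ := hf
  obtain ⟨Q', hQ', h'⟩ := hg
  refine ⟨fun M _ v y => ∃ a b, (Q M v a ∧ Q' M v b) ∧ y = mMul a b, ?_, fun M _ hM v y => ?_⟩
  · obtain ⟨φ, hφ⟩ := (((hQ.comp (Sum.elim (fun a => .inl (.inl (.inl a))) fun _ => .inl (.inr 0))).and
      (hQ'.comp (Sum.elim (fun a => .inl (.inl (.inl a))) fun _ => .inr 0))).and
      (UDef.eq (.var (.inl (.inl (.inr 0))) : arith.Term (((α ⊕ Fin 1) ⊕ Fin 1) ⊕ Fin 1))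
        (tMul (.var (.inl (.inr 0))) (.var (.inr 0))))).ex.ex
    exact ⟨φ, fun M _ v => (hφ M v).trans (by simp)⟩
  · simp only [h M hM, h' M hM, ← mMul_num hM]
    constructor
    · rintro ⟨a, b, ⟨rfl, rfl⟩, h⟩; exact h
    · exact fun h => ⟨_, _, ⟨rfl, rfl⟩, h⟩

lemma RepRel.le (hf : RepFun f) (hg : RepFun g) : RepRel fun v => f v ≤ g v := by
  have key : RepRel fun u : (α ⊕ Fin 1) ⊕ Fin 1 → ℕ => u (.inr 0) ≤ u (.inl (.inr 0)) :=
    ⟨_, UDef.le (.inr 0) (.inl (.inr 0)), fun M _ hM v => mLe_num_num hM⟩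
  exact RepRel.subst (R := fun v b => f v ≤ b) (RepRel.subst (α := α ⊕ Fin 1)
    (R := fun u b => b ≤ u (.inr 0)) (key) (hf.relabel Sum.inl)) hg

lemma RepRel.eq (hf : RepFun f) (hg : RepFun g) : RepRel fun v => f v = g v :=
  ((RepRel.le hf hg).and (RepRel.le hg hf)).of_iff fun _ => le_antisymm_iff.symm

lemma RepRel.lt (hf : RepFun f) (hg : RepFun g) : RepRel fun v => f v < g v :=
  (RepRel.le hg hf).not.of_iff fun _ => not_le

/-- The elements below a numeral are numerals, so a bounded quantifier has the same range in the
model as in ℕ. -/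
lemma RepRel.ball_le {R : (α → ℕ) → ℕ → Prop} (hf : RepFun f)
    (hR : RepRel fun u : α ⊕ Fin 1 → ℕ => R (fun a => u (.inl a)) (u (.inr 0))) :
    RepRel fun v => ∀ i ≤ f v, R v i := by
  refine RepRel.subst (R := fun v b => ∀ i ≤ b, R v i) ?_ hf
  obtain ⟨P, hP, h⟩ := hR
  refine ⟨_, ((UDef.le (.inr 0) (.inl (.inr 0))).imp
    (hP.comp (Sum.elim (fun a => .inl (.inl a)) fun _ => .inr 0))).all, fun M _ hM v => ?_⟩
  have e : ∀ j, (fun a : α ⊕ Fin 1 => (Sum.elim (fun a => num M (v a)) fun _ => num M j :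
      (α ⊕ Fin 1) ⊕ Fin 1 → M) (Sum.elim (fun a => .inl (.inl a)) (fun _ => .inr 0) a)) =
      fun a => num M (Sum.elim (fun a => v (.inl a)) (fun _ => j) a) := by
    intro j
    funext a
    rcases a with a | a <;> rfl
  constructor
  · intro H i hi
    have := H (num M i) ((mLe_num_num hM).2 hi)
    rw [e] at this
    exact (h M hM _).1 this
  · intro H y hy
    obtain ⟨j, hj, rfl⟩ := (mLe_num_iff hM).1 hy
    rw [e]
    exact (h M hM _).2 (H j hj)

lemma RepRel.bex_le {R : (α → ℕ) → ℕ → Prop} (hf : RepFun f)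
    (hR : RepRel fun u : α ⊕ Fin 1 → ℕ => R (fun a => u (.inl a)) (u (.inr 0))) :
    RepRel fun v => ∃ i ≤ f v, R v i :=
  (RepRel.ball_le (R := fun v i => ¬ R v i) hf hR.not).not.of_iff fun v => by simp

/-- A function defined by minimization of a representable relation is representable. -/
lemma RepFun.least {R : (α → ℕ) → ℕ → Prop}
    (hR : RepRel fun u : α ⊕ Fin 1 → ℕ => R (fun a => u (.inl a)) (u (.inr 0)))
    (hf : ∀ v, R v (f v)) (hmin : ∀ v, ∀ i < f v, ¬ R v i) : RepFun f := by
  obtain ⟨P, hP, h⟩ := hR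
  refine ⟨fun M _ v y => P M (Sum.elim v fun _ => y) ∧
    ∀ z, mLe z y → P M (Sum.elim v fun _ => z) → z = y, ?_, fun M _ hM v y => ?_⟩
  · obtain ⟨φ, hφ⟩ := hP.and ((UDef.le (.inr 0) (.inl (.inr 0))).imp
      ((hP.comp (Sum.elim (fun a => .inl (.inl a)) fun _ => .inr 0)).imp
        (UDef.eq (.var (.inr 0) : arith.Term ((α ⊕ Fin 1) ⊕ Fin 1)) (.var (.inl (.inr 0)))))).all
    have e : ∀ (M : Type) (u : α ⊕ Fin 1 → M) (y : M), (fun a => (Sum.elim u (fun _ => y) :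
        (α ⊕ Fin 1) ⊕ Fin 1 → M) (Sum.elim (fun a => .inl (.inl a)) (fun _ => .inr 0) a)) =
        (Sum.elim (fun a => u (.inl a)) fun _ => y : α ⊕ Fin 1 → M) := by
      intro M u y
      funext a
      rcases a with a | a <;> rfl
    have e' : ∀ (M : Type) (u : α ⊕ Fin 1 → M),
        (Sum.elim (fun a => u (.inl a)) fun _ => u (.inr 0) : α ⊕ Fin 1 → M) = u := by
      intro M u
      funext a
      rcases a with a | a
      · rfl
      · fin_cases a; rfl
    refine ⟨φ, fun M _ u => ?_⟩
    rw [hφ]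
    simp only [e, e']
    rfl
  · have e : ∀ j, (Sum.elim (fun a => num M (v a)) fun _ => num M j : α ⊕ Fin 1 → M) =
        fun a => num M (Sum.elim v (fun _ => j) a) := by
      intro j
      funext a
      rcases a with a | a <;> rfl
    have h1 : ∀ j, P M (Sum.elim (fun a => num M (v a)) fun _ => num M j) ↔ R v j := by
      intro j
      rw [e]
      exact h M hM _
    have h2 : ∀ j ≤ f v, R v j → j = f v := fun j hj hR => by
      by_contra hne
      exact hmin v j (lt_of_le_of_ne hj hne) hR
    constructor
    · rintro ⟨hy, hmin'⟩
      -- A solution below the true value is a numeral and is excluded by minimality in ℕ. For one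
      -- above it, its own minimality applied to the true value forces equality, so nonstandard
      -- solutions disappear.
      rcases mLe_total_num hM y (f v) with hle | hle
      · obtain ⟨j, hj, rfl⟩ := (mLe_num_iff hM).1 hle
        rw [h2 j hj ((h1 j).1 hy)]
      · exact (hmin' _ hle ((h1 _).2 (hf v))).symm
    · rintro rfl
      refine ⟨(h1 _).2 (hf v), fun z hz hPz => ?_⟩
      obtain ⟨j, hj, rfl⟩ := (mLe_num_iff hM).1 hz
      rw [h2 j hj ((h1 j).1 hPz)]

/-- A relation decided only at numerals may have nonstandard solutions; passing to the least element
of the graph restores uniqueness in every model. -/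
lemma RepFun.of_graph (hR : RepRel fun u : α ⊕ Fin 1 → ℕ => u (.inr 0) = f fun a => u (.inl a)) :
    RepFun f :=
  RepFun.least (R := fun v i => i = f v) hR (fun _ => rfl) fun _ _ hi => hi.ne

lemma RepFun.comp₁ {F : ℕ → ℕ} (hF : RepFun fun u : Fin 1 → ℕ => F (u 0)) (hf : RepFun f) :
    RepFun fun v => F (f v) := by
  refine RepFun.of_graph ?_
  refine RepRel.subst (α := α ⊕ Fin 1) (R := fun u b => u (.inr 0) = F b) ?_ (hf.relabel Sum.inl)
  exact RepRel.eq (.proj _) (hF.relabel fun _ => Sum.inr 0)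

end Rep

/-! ### Primitive recursive functions are representable -/

section PrimrecRep

variable {α : Type} {f g : (α → ℕ) → ℕ}

lemma RepFun.natPair (hf : RepFun f) (hg : RepFun g) : RepFun fun v => Nat.pair (f v) (g v) := by
  refine RepFun.of_graph ?_
  have hf' : RepFun fun u : α ⊕ Fin 1 → ℕ => f fun a => u (.inl a) := hf.relabel Sum.inl
  have hg' : RepFun fun u : α ⊕ Fin 1 → ℕ => g fun a => u (.inl a) := hg.relabel Sum.inl
  have hy : RepFun fun u : α ⊕ Fin 1 → ℕ => u (.inr 0) := .proj _
  refine (((RepRel.lt hf' hg').and (RepRel.eq hy ((hg'.mul hg').add hf'))).or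
    ((RepRel.le hg' hf').and (RepRel.eq hy (((hf'.mul hf').add hf').add hg')))).of_iff fun u => ?_
  unfold Nat.pair
  split_ifs with h
  · simp [h]
  · simp [h, not_lt.1 h]

lemma RepFun.unpair_fst (hf : RepFun f) : RepFun fun v => (Nat.unpair (f v)).1 := by
  refine RepFun.comp₁ (F := fun n => (Nat.unpair n).1) ?_ hf
  refine RepFun.least (R := fun v i => ∃ j ≤ v 0, Nat.pair i j = v 0)
    (RepRel.bex_le (α := Fin 1 ⊕ Fin 1) (R := fun u j => Nat.pair (u (.inr 0)) j = u (.inl 0)) (.proj (Sum.inl 0))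
      (RepRel.eq (RepFun.natPair (.proj (Sum.inl (Sum.inr 0))) (.proj (Sum.inr 0))) (.proj (Sum.inl (Sum.inl 0)))))
    (fun v => ⟨_, Nat.unpair_right_le _, Nat.pair_unpair _⟩) ?_
  rintro v i hi ⟨j, -, hj⟩
  rw [← hj, Nat.unpair_pair] at hi
  exact lt_irrefl _ hi

lemma RepFun.unpair_snd (hf : RepFun f) : RepFun fun v => (Nat.unpair (f v)).2 := by
  refine RepFun.comp₁ (F := fun n => (Nat.unpair n).2) ?_ hf
  refine RepFun.least (R := fun v i => ∃ j ≤ v 0, Nat.pair j i = v 0)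
    (RepRel.bex_le (α := Fin 1 ⊕ Fin 1) (R := fun u j => Nat.pair j (u (.inr 0)) = u (.inl 0)) (.proj (Sum.inl 0))
      (RepRel.eq (RepFun.natPair (.proj (Sum.inr 0)) (.proj (Sum.inl (Sum.inr 0)))) (.proj (Sum.inl (Sum.inl 0)))))
    (fun v => ⟨_, Nat.unpair_left_le _, Nat.pair_unpair _⟩) ?_
  rintro v i hi ⟨j, -, hj⟩
  rw [← hj, Nat.unpair_pair] at hi
  exact lt_irrefl _ hi

lemma RepFun.mod_succ (hf : RepFun f) (hg : RepFun g) : RepFun fun v => f v % (g v + 1) := by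
  refine RepFun.of_graph ?_
  have hf' : RepFun fun u : α ⊕ Fin 1 → ℕ => f fun a => u (.inl a) := hf.relabel Sum.inl
  have hg' : RepFun fun u : α ⊕ Fin 1 → ℕ => g fun a => u (.inl a) := hg.relabel Sum.inl
  have hy : RepFun fun u : α ⊕ Fin 1 → ℕ => u (.inr 0) := .proj _
  refine ((RepRel.lt hy hg'.succ).and (RepRel.bex_le
    (R := fun u q => u (.inr 0) + ((g fun a => u (.inl a)) + 1) * q = f fun a => u (.inl a)) hf' ?_)).of_iff
      fun u => ?_
  · exact RepRel.eq (((hy.relabel Sum.inl)).add ((hg'.succ.relabel Sum.inl).mul (.proj (Sum.inr 0))))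
      (hf'.relabel Sum.inl)
  · constructor
    · rintro ⟨h, q, -, hq⟩
      rw [← hq, Nat.add_mul_mod_self_left, Nat.mod_eq_of_lt h]
    · intro h
      rw [h]
      exact ⟨Nat.mod_lt _ (Nat.succ_pos _), _, Nat.div_le_self _ _, Nat.mod_add_div _ _⟩

lemma RepFun.beta (hf : RepFun f) (hg : RepFun g) : RepFun fun v => Nat.beta (f v) (g v) :=
  hf.unpair_fst.mod_succ (hg.succ.mul hf.unpair_snd)

lemma exists_beta_eq (F : ℕ → ℕ) (n : ℕ) : ∃ c, ∀ i ≤ n, Nat.beta c i = F i := by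
  refine ⟨Nat.unbeta ((List.range (n + 1)).map F), fun i hi => ?_⟩
  have := Nat.beta_unbeta_coe ((List.range (n + 1)).map F) ⟨i, by simp; omega⟩
  simpa using this

/-- Every primitive recursive function is representable. -/
lemma RepFun.of_primrec {F : ℕ → ℕ} (hF : Nat.Primrec F) : RepFun fun v : Fin 1 → ℕ => F (v 0) := by
  induction hF with
  | zero => exact .zero
  | succ => exact (RepFun.proj 0).succ
  | left => exact (RepFun.proj 0).unpair_fst
  | right => exact (RepFun.proj 0).unpair_snd
  | pair _ _ ihf ihg => exact ihf.natPair ihg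
  | comp _ _ ihf ihg => exact RepFun.comp₁ ihf ihg
  | @prec F G _ _ ihf ihg =>
    classical
    let H : ℕ → ℕ → ℕ := fun z n => n.rec (F z) fun y IH => G (Nat.pair z (Nat.pair y IH))
    -- `c` codes, by Gödel's β function, the whole course of the recursion. Codes are not unique, so
    -- the least one is taken; any of them gives the same final value.
    let R : (Fin 1 → ℕ) → ℕ → Prop := fun v c => Nat.beta c 0 = F (v 0).unpair.1 ∧
      ∀ i ≤ (v 0).unpair.2, i < (v 0).unpair.2 →
        Nat.beta c (i + 1) = G (Nat.pair (v 0).unpair.1 (Nat.pair i (Nat.beta c i)))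
    have hR : RepRel fun u : Fin 1 ⊕ Fin 1 → ℕ => R (fun a => u (.inl a)) (u (.inr 0)) := by
      have p : RepFun fun u : Fin 1 ⊕ Fin 1 → ℕ => u (.inl 0) := .proj _
      have p' : RepFun fun u : (Fin 1 ⊕ Fin 1) ⊕ Fin 1 → ℕ => u (.inl (.inl 0)) := .proj _
      have c' : RepFun fun u : (Fin 1 ⊕ Fin 1) ⊕ Fin 1 → ℕ => u (.inl (.inr 0)) := .proj _
      have i' : RepFun fun u : (Fin 1 ⊕ Fin 1) ⊕ Fin 1 → ℕ => u (.inr 0) := .proj _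
      refine (RepRel.eq (RepFun.beta (.proj _) .zero) (RepFun.comp₁ ihf p.unpair_fst)).and
        (RepRel.ball_le (R := fun u i => i < (u (.inl 0)).unpair.2 →
        Nat.beta (u (.inr 0)) (i + 1) = G (Nat.pair (u (.inl 0)).unpair.1
          (Nat.pair i (Nat.beta (u (.inr 0)) i)))) p.unpair_snd ?_)
      exact (RepRel.lt i' p'.unpair_snd).imp (RepRel.eq (c'.beta i'.succ)
        (RepFun.comp₁ ihg (p'.unpair_fst.natPair (i'.natPair (c'.beta i')))))
    have hex : ∀ v, ∃ c, R v c := by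
      intro v
      obtain ⟨c, hc⟩ := exists_beta_eq (H (v 0).unpair.1) (v 0).unpair.2
      refine ⟨c, hc 0 (Nat.zero_le _), fun i _ hi => ?_⟩
      rw [hc _ hi, hc _ hi.le]
    have hval : ∀ v c, R v c → Nat.beta c (v 0).unpair.2 = H (v 0).unpair.1 (v 0).unpair.2 := by
      rintro v c ⟨h0, hs⟩
      have : ∀ i ≤ (v 0).unpair.2, Nat.beta c i = H (v 0).unpair.1 i := by
        intro i
        induction i with
        | zero => exact fun _ => h0
        | succ i ih =>
          intro hi
          rw [hs i (by omega) (by omega), ih (by omega)]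
      exact this _ le_rfl
    have hc : RepFun fun v => Nat.find (hex v) :=
      RepFun.least hR (fun v => Nat.find_spec (hex v)) fun v i hi => Nat.find_min (hex v) hi
    exact (hc.beta (RepFun.proj 0).unpair_snd).of_eq fun v => hval v _ (Nat.find_spec (hex v))

lemma RepRel.of_primrecRel {D : ℕ → ℕ → Prop} (hD : PrimrecRel D) :
    RepRel fun u : Fin 1 ⊕ Fin 1 → ℕ => D (u (.inl 0)) (u (.inr 0)) := by
  obtain ⟨hdec, hD⟩ := hD
  have h : Nat.Primrec fun n => (decide (D n.unpair.1 n.unpair.2)).toNat := by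
    rw [← Primrec.nat_iff]
    exact (Primrec.dom_bool Bool.toNat).comp (hD.comp Primrec.unpair)
  refine (RepRel.eq (RepFun.comp₁ (RepFun.of_primrec h)
    (RepFun.natPair (.proj (.inl 0)) (.proj (Sum.inr 0)))) (.const 1)).of_iff fun u => ?_
  rw [Nat.unpair_pair]
  by_cases hu : D (u (.inl 0)) (u (.inr 0)) <;> simp [hu]

end PrimrecRep

/-! ### Injectivity of the Gödel numbering -/

section Injective

variable {L : FirstOrder.Language.{0, 0}} (ν : EffectiveLanguage L)

lemma termCode_injective {n : ℕ} : Function.Injective (ν.termCode (n := n)) := by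
  intro s
  induction s with
  | var a =>
    rcases a with e | i
    · exact e.elim
    · rintro (b | ⟨f, ts⟩) h
      · rcases b with e | j
        · exact e.elim
        · simp only [EffectiveLanguage.termCode, Nat.pair_eq_pair, true_and] at h
          rw [Fin.ext h]
      · simp [EffectiveLanguage.termCode, Nat.pair_eq_pair] at h
  | @func l f ts ih =>
    rintro (b | @⟨l', f', ts'⟩) h
    · rcases b with e | j
      · exact e.elim
      · simp [EffectiveLanguage.termCode, Nat.pair_eq_pair] at h
    · simp only [EffectiveLanguage.termCode, Nat.pair_eq_pair, true_and] at h
      obtain ⟨⟨rfl, h1⟩, h2⟩ := h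
      obtain rfl := ν.funCode_injective _ h1
      have h3 := List.ofFn_injective (Encodable.encode_injective h2)
      congr 1
      funext i
      exact ih i (congrFun h3 i)

lemma formulaCode_injective {n : ℕ} : Function.Injective (ν.formulaCode (n := n)) := by
  intro φ
  induction φ with
  | falsum =>
    intro ψ h
    cases ψ <;> simp [EffectiveLanguage.formulaCode, Nat.pair_eq_pair] at h ⊢
  | equal s t =>
    intro ψ h
    cases ψ <;> simp [EffectiveLanguage.formulaCode, Nat.pair_eq_pair] at h ⊢
    exact ⟨termCode_injective ν h.1, termCode_injective ν h.2⟩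
  | @rel n l R ts =>
    intro ψ h
    cases ψ with
    | @rel _ l' R' ts' =>
      simp only [EffectiveLanguage.formulaCode, Nat.pair_eq_pair, true_and] at h
      obtain ⟨⟨rfl, h1⟩, h2⟩ := h
      obtain rfl := ν.relCode_injective _ h1
      have h3 := List.ofFn_injective (Encodable.encode_injective h2)
      congr 1
      funext i
      exact termCode_injective ν (congrFun h3 i)
    | _ => simp [EffectiveLanguage.formulaCode, Nat.pair_eq_pair] at h
  | imp φ₁ φ₂ ih₁ ih₂ =>
    intro ψ h
    cases ψ <;> simp [EffectiveLanguage.formulaCode, Nat.pair_eq_pair] at h ⊢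
    exact ⟨ih₁ h.1, ih₂ h.2⟩
  | all φ ih =>
    intro ψ h
    cases ψ <;> simp [EffectiveLanguage.formulaCode, Nat.pair_eq_pair] at h ⊢
    exact ih h

lemma formulaCode_mem_codes {T : Set L.Sentence} {φ : L.Sentence} :
    ν.formulaCode φ ∈ ν.codes T ↔ φ ∈ T :=
  ⟨fun ⟨_, h, e⟩ => formulaCode_injective ν e ▸ h, fun h => ⟨φ, h, rfl⟩⟩

end Injective

/-! ### Separation by complete extensions of Peano Arithmetic -/

/-- The numeral of a natural number. -/
def numeral {α : Type} : ℕ → arith.Term α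
  | 0 => tZero
  | n + 1 => tSucc (numeral n)

lemma realize_numeral {M α : Type} [arith.Structure M] (v : α → M) (n : ℕ) :
    (numeral n : arith.Term α).realize v = num M n := by
  induction n with
  | zero => exact realize_tZero v
  | succ n ih => rw [numeral, realize_tSucc, ih]; rfl

lemma primrec_termCode_numeral (k : ℕ) :
    Primrec fun n => arithEffective.termCode (numeral n : arith.Term (Empty ⊕ Fin k)) := by
  have h : Primrec fun n : ℕ => (n.rec (Nat.pair 1 (Nat.pair (Nat.pair 0 0) 0))
      fun _ t => Nat.pair 1 (Nat.pair (Nat.pair 1 1) (Nat.pair t 0 + 1)) : ℕ) := by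
    refine Primrec.nat_rec₁ _ ?_
    exact Primrec₂.natPair.comp (Primrec.const 1) (Primrec₂.natPair.comp (Primrec.const _)
      (Primrec.succ.comp (Primrec₂.natPair.comp Primrec.snd (Primrec.const 0))))
  refine h.of_eq fun n => ?_
  induction n with
  | zero => rfl
  | succ n ih =>
    simp only at ih ⊢
    rw [ih]
    rfl

/-- The sentence `∀ y, y = n → φ(y)`. -/
def instNumeral (φ : arith.Formula (Fin 1)) (n : ℕ) : arith.Sentence :=
  BoundedFormula.all (n := 0)
    (.imp (.equal (.var (.inr 0)) (numeral n)) (bindVars φ))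

lemma realize_instNumeral {M : Type} [arith.Structure M] (φ : arith.Formula (Fin 1)) (n : ℕ) :
    M ⊨ instNumeral φ n ↔ φ.Realize fun _ => num M n := by
  have : M ⊨ instNumeral φ n ↔ ∀ y : M, y = num M n → φ.Realize fun _ => y := by
    unfold instNumeral Sentence.Realize Formula.Realize
    rw [BoundedFormula.realize_all]
    refine forall_congr' fun y => ?_
    rw [BoundedFormula.realize_imp]
    refine imp_congr ?_ ?_
    · change (Term.realize _ _ = Term.realize _ (numeral n)) ↔ _
      rw [realize_numeral]
      rfl
    · rw [bindVars, BoundedFormula.realize_relabel]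
      refine iff_of_eq (congrArg₂ (fun w x => BoundedFormula.Realize φ w x) ?_ ?_)
      · funext i
        fin_cases i
        rfl
      · exact Subsingleton.elim (α := Fin 0 → M) _ _
  rw [this, forall_eq]

/-- In this form the numeral occurs once, at a fixed place, so the code is a fixed expression in the
code of the numeral. Literal substitution would require a recursion on `φ`. -/
lemma primrec_formulaCode_instNumeral (φ : arith.Formula (Fin 1)) :
    Primrec fun n => arithEffective.formulaCode (instNumeral φ n) := by
  have h : Primrec fun n : ℕ => Nat.pair 4 (Nat.pair 3 (Nat.pair (Nat.pair 1 (Nat.pair (Nat.pair 0 0)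
      (arithEffective.termCode (numeral n : arith.Term (Empty ⊕ Fin 1)))))
      (arithEffective.formulaCode (bindVars φ)))) :=
    Primrec₂.natPair.comp (Primrec.const 4) (Primrec₂.natPair.comp (Primrec.const 3)
      (Primrec₂.natPair.comp (Primrec₂.natPair.comp (Primrec.const 1) (Primrec₂.natPair.comp
        (Primrec.const _) (primrec_termCode_numeral 1))) (Primrec.const _)))
  exact h.of_eq fun n => rfl

/-- A complete extension of Peano Arithmetic separates, uniformly, what becomes true by a first
relation from what becomes true by a second one. -/
theorem exists_primrec_separating {U : arith.Theory} (hPA : PA ⊆ U) (hU : IsCompleteTheory U)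
    {D₀ D₁ : ℕ → ℕ → Prop} (h₀ : PrimrecRel D₀) (h₁ : PrimrecRel D₁) :
    ∃ g : ℕ → ℕ, Primrec g ∧ ∀ x,
      ((∃ s, D₁ x s) → (∀ s, ¬ D₀ x s) → g x ∈ arithEffective.codes U) ∧
      ((∃ s, D₀ x s) → (∀ s, ¬ D₁ x s) → g x ∉ arithEffective.codes U) := by
  obtain ⟨P₀, hP₀, H₀⟩ := RepRel.of_primrecRel h₀
  obtain ⟨P₁, hP₁, H₁⟩ := RepRel.of_primrecRel h₁
  -- The Rosser formula: some `w` witnesses the second relation, and no `u ≤ w` witnesses the first.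
  obtain ⟨φ, hφ⟩ := (hP₁.and ((UDef.le (.inr 0) (.inl (.inr 0))).imp
    (hP₀.comp (Sum.elim (fun a => Sum.inl (Sum.inl a)) fun _ => Sum.inr 0)).not).all).ex
  have e : ∀ (M : Type) [arith.Structure M] (x s : ℕ),
      (Sum.elim (fun _ => num M x) fun _ => num M s : Fin 1 ⊕ Fin 1 → M) =
        fun a => num M (Sum.elim (fun _ => x) (fun _ => s) a) := by
    intro M _ x s
    funext a
    rcases a with a | a <;> rfl
  have e' : ∀ (M : Type) (x y z : M), (fun a => (Sum.elim (Sum.elim (fun _ => x) fun _ => y)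
      (fun _ => z) : (Fin 1 ⊕ Fin 1) ⊕ Fin 1 → M)
        (Sum.elim (fun a => Sum.inl (Sum.inl a)) (fun _ => Sum.inr 0) a)) =
      (Sum.elim (fun _ => x) fun _ => z : Fin 1 ⊕ Fin 1 → M) := by
    intro M x y z
    funext a
    rcases a with a | a <;> rfl
  have key : ∀ (M : Type) [arith.Structure M] (x : ℕ), M ⊨ instNumeral φ x ↔
      ∃ w : M, P₁ M (Sum.elim (fun _ => num M x) fun _ => w) ∧
        ∀ u : M, mLe u w → ¬ P₀ M (Sum.elim (fun _ => num M x) fun _ => u) := by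
    intro M _ x
    rw [realize_instNumeral, hφ]
    simp only [e']
    rfl
  have K₀ : ∀ (M : Type) [arith.Structure M], M ⊨ PA → ∀ x s : ℕ,
      P₀ M (Sum.elim (fun _ => num M x) fun _ => num M s) ↔ D₀ x s := by
    intro M _ hM x s
    rw [e]
    exact H₀ M hM _
  have K₁ : ∀ (M : Type) [arith.Structure M], M ⊨ PA → ∀ x s : ℕ,
      P₁ M (Sum.elim (fun _ => num M x) fun _ => num M s) ↔ D₁ x s := by
    intro M _ hM x s
    rw [e]
    exact H₁ M hM _
  refine ⟨_, primrec_formulaCode_instNumeral φ, fun x => ⟨fun ⟨s, hs⟩ hno => ?_,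
    fun ⟨s, hs⟩ hno hmem => ?_⟩⟩
  · rw [formulaCode_mem_codes]
    refine hU.1 _ (Theory.models_sentence_iff.2 fun M => ?_)
    have hM : M ⊨ PA := M.is_model.mono hPA
    rw [key]
    refine ⟨num M s, (K₁ M hM x s).2 hs, fun u hu => ?_⟩
    obtain ⟨j, -, rfl⟩ := (mLe_num_iff hM).1 hu
    rw [K₀ M hM]
    exact hno j
  · rw [formulaCode_mem_codes] at hmem
    obtain ⟨M⟩ := hU.2.1
    have hM : M ⊨ PA := M.is_model.mono hPA
    have h := Theory.realize_sentence_of_mem (M := M) U hmem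
    rw [key] at h
    obtain ⟨w, hw, hw'⟩ := h
    -- The witness `w` may be nonstandard. If `w ≤ s` it is a numeral, contrary to `hno`; otherwise
    -- `s` is a witness of the first relation below `w`.
    rcases mLe_total_num hM w s with hle | hle
    · obtain ⟨j, -, rfl⟩ := (mLe_num_iff hM).1 hle
      exact hno j ((K₁ M hM x j).1 hw)
    · exact hw' _ hle ((K₀ M hM x s).2 hs)

/-! ### Members of effectively closed classes -/

section Path

/-- The literals of the clause are about places below `s`, and are false when the truth values are
the binary digits of `r`. -/
def Falsified (c : List (ℕ × Bool)) (s r : ℕ) : Prop := ∀ q ∈ c, q.1 < s ∧ r.testBit q.1 ≠ q.2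

/-- No extension to length `s` of the `n` binary digits of `t` agrees with the first `s` clauses. -/
def Dead (cl : ℕ → List (ℕ × Bool)) (n t s : ℕ) : Prop :=
  n ≤ s ∧ ∀ r < 2 ^ s, r % 2 ^ n = t → ∃ j < s, Falsified (cl j) s r

lemma primrec₂_testBit : Primrec₂ Nat.testBit := by
  have hp : Primrec₂ fun a b : ℕ => a ^ b := Primrec₂.unpaired'.1 Nat.Primrec.pow
  have h : PrimrecRel fun r i : ℕ => r / 2 ^ i % 2 = 1 :=
    Primrec.eq.comp (Primrec.nat_mod.comp (Primrec.nat_div.comp Primrec.fst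
      (hp.comp (Primrec.const 2) Primrec.snd)) (Primrec.const 2)) (Primrec.const 1)
  exact h.decide.of_eq fun p i => by rw [Nat.testBit_eq_decide_div_mod_eq]

lemma primrecPred_ball_lt {β : Type} [Primcodable β] {R : ℕ → β → Prop} {f : β → ℕ}
    (hR : PrimrecRel R) (hf : Primrec f) : PrimrecPred fun b => ∀ i < f b, R i b :=
  (hR.forall_mem_list.comp (Primrec.list_range.comp hf) Primrec.id).of_eq (by simp)

lemma primrecPred_bex_lt {β : Type} [Primcodable β] {R : ℕ → β → Prop} {f : β → ℕ}
    (hR : PrimrecRel R) (hf : Primrec f) : PrimrecPred fun b => ∃ i < f b, R i b :=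
  (hR.exists_mem_list.comp (Primrec.list_range.comp hf) Primrec.id).of_eq (by simp)

lemma primrec_two_pow {β : Type} [Primcodable β] {f : β → ℕ} (hf : Primrec f) :
    Primrec fun b => 2 ^ f b :=
  (Primrec₂.unpaired'.1 Nat.Primrec.pow : Primrec₂ fun a b : ℕ => a ^ b).comp (Primrec.const 2) hf

lemma primrecRel_falsified :
    PrimrecRel fun (c : List (ℕ × Bool)) (p : ℕ × ℕ) => Falsified c p.1 p.2 := by
  have h : PrimrecRel fun (q : ℕ × Bool) (p : ℕ × ℕ) => q.1 < p.1 ∧ p.2.testBit q.1 ≠ q.2 :=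
    PrimrecPred.and (Primrec.nat_lt.comp (Primrec.fst.comp Primrec.fst) (Primrec.fst.comp Primrec.snd))
      (PrimrecPred.not (Primrec.eq.comp (primrec₂_testBit.comp (Primrec.snd.comp Primrec.snd)
        (Primrec.fst.comp Primrec.fst)) (Primrec.snd.comp Primrec.fst)))
  exact h.forall_mem_list

variable {cl : ℕ → List (ℕ × Bool)}

lemma primrecPred_dead (hcl : Primrec cl) :
    PrimrecPred fun p : ℕ × ℕ × ℕ => Dead cl p.1 p.2.1 p.2.2 := by
  have h₁ : PrimrecRel fun (j : ℕ) (p : ℕ × ℕ × ℕ × ℕ) => Falsified (cl j) p.2.2.2 p.1 :=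
    primrecRel_falsified.comp (hcl.comp Primrec.fst)
      (Primrec.pair (Primrec.snd.comp (Primrec.snd.comp (Primrec.snd.comp Primrec.snd)))
        (Primrec.fst.comp Primrec.snd))
  have h₂ : PrimrecRel fun (r : ℕ) (p : ℕ × ℕ × ℕ) => ¬ r % 2 ^ p.1 = p.2.1 ∨
      ∃ j < p.2.2, Falsified (cl j) p.2.2 r :=
    PrimrecPred.or (PrimrecPred.not (Primrec.eq.comp (Primrec.nat_mod.comp Primrec.fst
      (primrec_two_pow (Primrec.fst.comp Primrec.snd)))
        (Primrec.fst.comp (Primrec.snd.comp Primrec.snd))))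
      (primrecPred_bex_lt h₁ (Primrec.snd.comp (Primrec.snd.comp Primrec.snd)))
  refine (PrimrecPred.and (Primrec.nat_le.comp Primrec.fst (Primrec.snd.comp Primrec.snd))
    (primrecPred_ball_lt h₂ (primrec_two_pow (Primrec.snd.comp Primrec.snd)))).of_eq fun p => ?_
  simp only [Dead, imp_iff_not_or]

/-- A clause falsified by the first `s` digits mentions only places below `s`, so it stays falsified
by every longer string. Deaths observed at different stages can thus be brought to a common one. -/
lemma Dead.mono {n t s s' : ℕ} (h : Dead cl n t s) (hs : s ≤ s') : Dead cl n t s' := by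
  refine ⟨h.1.trans hs, fun r _ hr => ?_⟩
  obtain ⟨j, hj, hF⟩ := h.2 (r % 2 ^ s) (Nat.mod_lt _ (by positivity))
    (by rw [Nat.mod_mod_of_dvd _ (pow_dvd_pow 2 h.1), hr])
  refine ⟨j, hj.trans_le hs, fun q hq => ?_⟩
  obtain ⟨h1, h2⟩ := hF q hq
  rw [Nat.testBit_mod_two_pow] at h2
  exact ⟨h1.trans_le hs, by simpa [h1] using h2⟩

/-- Every string extending `t` passes through one of its two children, so an alive node has an alive
child. -/
lemma Dead.of_children {n t s s' : ℕ} (h : Dead cl (n + 1) t s) (h' : Dead cl (n + 1) (t + 2 ^ n) s') :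
    Dead cl n t (max s s') := by
  refine ⟨by have := h.1; omega, fun r hr hrt => ?_⟩
  have e : r % 2 ^ (n + 1) = r % 2 ^ n + 2 ^ n * (r / 2 ^ n % 2) := Nat.mod_pow_succ
  rcases Nat.mod_two_eq_zero_or_one (r / 2 ^ n) with h0 | h1
  · exact (h.mono (le_max_left _ _)).2 r hr (by rw [e, h0, hrt]; simp)
  · exact (h'.mono (le_max_right _ _)).2 r hr (by rw [e, h1, hrt]; simp)

lemma exists_testBit_eq (X : ℕ → Bool) (s : ℕ) :
    ∃ r < 2 ^ s, ∀ i < s, r.testBit i = X i := by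
  induction s with
  | zero => exact ⟨0, by simp, by simp⟩
  | succ s ih =>
    obtain ⟨r, hr, h⟩ := ih
    cases hX : X s with
    | false =>
      refine ⟨r, hr.trans (Nat.pow_lt_pow_succ one_lt_two), fun i hi => ?_⟩
      rcases Nat.lt_succ_iff_lt_or_eq.1 hi with hi | rfl
      · exact h i hi
      · rw [hX, Nat.testBit_lt_two_pow hr]
    | true =>
      refine ⟨2 ^ s + r, by rw [pow_succ]; omega, fun i hi => ?_⟩
      rcases Nat.lt_succ_iff_lt_or_eq.1 hi with hi | rfl
      · rw [Nat.testBit_two_pow_add_gt hi, h i hi]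
      · rw [Nat.testBit_two_pow_add_eq, Nat.testBit_lt_two_pow hr, hX]; rfl

/-- The initial segment of a satisfying assignment falsifies no clause, so the root is alive at
every stage. -/
lemma not_dead_zero {X : ℕ → Bool} (hX : ∀ n, ∃ q ∈ cl n, X q.1 = q.2) (s : ℕ) :
    ¬ Dead cl 0 0 s := by
  rintro ⟨-, h⟩
  obtain ⟨r, hr, hrX⟩ := exists_testBit_eq X s
  obtain ⟨j, -, hj⟩ := h r hr (Nat.mod_one r)
  obtain ⟨q, hq, hqX⟩ := hX j
  obtain ⟨h1, h2⟩ := hj q hq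
  exact h2 (by rw [hrX _ h1, hqX])

/-- The approximations to the member of the class that the choice function `b` leads to. -/
def pathApprox (b : ℕ → ℕ → ℕ) (n : ℕ) : ℕ := n.rec 0 fun n r => r + 2 ^ n * b n r

lemma pathApprox_succ (b : ℕ → ℕ → ℕ) (n : ℕ) :
    pathApprox b (n + 1) = pathApprox b n + 2 ^ n * b n (pathApprox b n) := rfl

lemma testBit_pathApprox (b : ℕ → ℕ → ℕ) {i n m : ℕ} (hi : i < n) (hm : n ≤ m) :
    (pathApprox b m).testBit i = (pathApprox b n).testBit i := by
  induction m, hm using Nat.le_induction with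
  | base => rfl
  | succ m hm ih =>
    rw [← ih, pathApprox_succ]
    have h : ∀ r, r.testBit i = (r % 2 ^ m).testBit i := fun r => by
      rw [Nat.testBit_mod_two_pow]; simp [hi.trans_le hm]
    rw [h, Nat.add_mul_mod_self_left, ← h]

/-- A satisfiable primitive recursive set of clauses is satisfied along the path that never takes
a dead branch. -/
lemma pathApprox_satisfies {b : ℕ → ℕ → ℕ} (hb : ∀ n r, b n r ≤ 1)
    {X : ℕ → Bool} (hX : ∀ n, ∃ q ∈ cl n, X q.1 = q.2)
    (h₀ : ∀ n t, (∃ s, Dead cl (n + 1) (t + 2 ^ n) s) → (∀ s, ¬ Dead cl (n + 1) t s) → b n t = 0)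
    (h₁ : ∀ n t, (∃ s, Dead cl (n + 1) t s) → (∀ s, ¬ Dead cl (n + 1) (t + 2 ^ n) s) → b n t = 1)
    (j : ℕ) : ∃ q ∈ cl j, (pathApprox b (q.1 + 1)).testBit q.1 = q.2 := by
  -- If the child chosen dies, either the other one dies too, and then the parent was dead, or the
  -- other stays alive, and then `h₀` or `h₁` dictates the opposite choice.
  have alive : ∀ n s, ¬ Dead cl n (pathApprox b n) s := by
    intro n
    induction n with
    | zero => exact not_dead_zero hX
    | succ n ih =>
      intro s hs
      rw [pathApprox_succ] at hs
      rcases Nat.le_one_iff_eq_zero_or_eq_one.1 (hb n (pathApprox b n)) with hb0 | hb1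
      · rw [hb0, mul_zero, add_zero] at hs
        by_cases h : ∃ s', Dead cl (n + 1) (pathApprox b n + 2 ^ n) s'
        · obtain ⟨s', hs'⟩ := h
          exact ih _ (hs.of_children hs')
        · have := h₁ n _ ⟨s, hs⟩ (not_exists.1 h)
          omega
      · rw [hb1, mul_one] at hs
        by_cases h : ∃ s', Dead cl (n + 1) (pathApprox b n) s'
        · obtain ⟨s', hs'⟩ := h
          exact ih _ (hs'.of_children hs)
        · have := h₀ n _ ⟨s, hs⟩ (not_exists.1 h)
          omega
  -- This level exceeds `j` and every place mentioned in clause `j`, so being alive there means that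
  -- some literal of the clause is true.
  let s := ((cl j).map Prod.fst).sum + j + 1
  have hs : ∀ q ∈ cl j, q.1 < s := fun q hq => by
    have := List.le_sum_of_mem (List.mem_map_of_mem (f := Prod.fst) hq)
    omega
  have h := alive s s
  simp only [Dead, le_refl, true_and, not_forall] at h
  obtain ⟨r, hr, hrs, h⟩ := h
  rw [Nat.mod_eq_of_lt hr] at hrs
  subst hrs
  have h' : ¬ Falsified (cl j) s (pathApprox b s) := fun hF => h ⟨j, by omega, hF⟩
  simp only [Falsified, not_forall] at h'
  obtain ⟨q, hq, hq'⟩ := h'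
  refine ⟨q, hq, ?_⟩
  rw [← testBit_pathApprox b (Nat.lt_succ_self q.1) (hs q hq)]
  by_contra hne
  exact hq' ⟨hs q hq, hne⟩

end Path

/-! ### Oracle computation of a member of an effectively closed class -/

section Relative

variable {O : Set (ℕ →. ℕ)}

lemma recursiveIn_comp {f g : ℕ → ℕ} (hf : Nat.RecursiveIn O (f : ℕ →. ℕ))
    (hg : Nat.RecursiveIn O (g : ℕ →. ℕ)) : Nat.RecursiveIn O (fun n => f (g n) : ℕ → ℕ) :=
  (hf.comp hg).of_eq fun _ => Part.bind_some _ _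

lemma recursiveIn_pair {f g : ℕ → ℕ} (hf : Nat.RecursiveIn O (f : ℕ →. ℕ))
    (hg : Nat.RecursiveIn O (g : ℕ →. ℕ)) :
    Nat.RecursiveIn O (fun n => Nat.pair (f n) (g n) : ℕ → ℕ) :=
  (hf.pair hg).of_eq fun n => by simp [Seq.seq]

lemma recursiveIn_primrec {f : ℕ → ℕ} (hf : Primrec f) : Nat.RecursiveIn O (f : ℕ →. ℕ) :=
  (Primrec.nat_iff.1 hf).recursiveIn

/-- Iteration of an oracle-computable step, with access to the stage. -/
lemma recursiveIn_rec {h : ℕ → ℕ} (hh : Nat.RecursiveIn O (h : ℕ →. ℕ)) (c : ℕ) :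
    Nat.RecursiveIn O (fun n => n.rec c fun y i => h (Nat.pair y i) : ℕ → ℕ) := by
  have h₁ : Nat.RecursiveIn O (fun p => h p.unpair.2 : ℕ → ℕ) :=
    recursiveIn_comp hh (recursiveIn_primrec (Primrec.snd.comp Primrec.unpair))
  have h₂ := (recursiveIn_primrec (O := O) (Primrec.const c)).prec h₁
  refine (h₂.comp (recursiveIn_primrec (O := O) (f := fun n => Nat.pair 0 n)
    (Primrec₂.natPair.comp (Primrec.const 0) Primrec.id))).of_eq fun n => ?_
  simp only [PFun.coe_val, Part.bind_eq_bind, Part.bind_some, Nat.unpair_pair]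
  induction n with
  | zero => rfl
  | succ n ih =>
    simp only at ih ⊢
    rw [ih]
    simp

/-- An effectively closed class that is nonempty has a member computable from any complete
extension of Peano Arithmetic. -/
theorem exists_member_turingReducible {U : arith.Theory} (hPA : PA ⊆ U) (hU : IsCompleteTheory U)
    {cl : ℕ → List (ℕ × Bool)} (hcl : Primrec cl) {X : ℕ → Bool}
    (hX : ∀ n, ∃ q ∈ cl n, X q.1 = q.2) :
    ∃ Y : ℕ → Bool, (∀ n, ∃ q ∈ cl n, Y q.1 = q.2) ∧
      TuringReducible (fun n => (Y n).toNat : ℕ → ℕ) (charFun (arithEffective.codes U) : ℕ →. ℕ) := by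
  have hn : Primrec fun p : ℕ × ℕ => p.1.unpair.1 := Primrec.fst.comp (Primrec.unpair.comp Primrec.fst)
  have ht : Primrec fun p : ℕ × ℕ => p.1.unpair.2 := Primrec.snd.comp (Primrec.unpair.comp Primrec.fst)
  -- Here `x` codes a node `r` of length `n`; the two relations say that its child with next digit
  -- 0, respectively 1, is dead by stage `s`.
  have hD₀ : PrimrecRel fun x s : ℕ => Dead cl (x.unpair.1 + 1) x.unpair.2 s :=
    (primrecPred_dead hcl).comp (Primrec.pair (Primrec.succ.comp hn) (Primrec.pair ht Primrec.snd))
  have hD₁ : PrimrecRel fun x s : ℕ => Dead cl (x.unpair.1 + 1) (x.unpair.2 + 2 ^ x.unpair.1) s :=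
    (primrecPred_dead hcl).comp (Primrec.pair (Primrec.succ.comp hn) (Primrec.pair
      (Primrec.nat_add.comp ht (primrec_two_pow hn)) Primrec.snd))
  obtain ⟨g, hg, hsep⟩ := exists_primrec_separating hPA hU hD₀ hD₁
  set χ := charFun (arithEffective.codes U) with hχ
  -- When just one child dies, membership in the extension signals that it is the child with digit
  -- 1. The digit taken is then 0, hence the complement.
  let b : ℕ → ℕ → ℕ := fun n r => 1 - χ (g (Nat.pair n r))
  have hb : ∀ n r, b n r ≤ 1 := fun n r => Nat.sub_le _ _
  refine ⟨fun n => (pathApprox b (n + 1)).testBit n, ?_, ?_⟩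
  · refine pathApprox_satisfies hb hX (fun n t h h' => ?_) fun n t h h' => ?_
    · have := (hsep (Nat.pair n t)).1 (by simpa using h) (by simpa using h')
      simp [b, hχ, charFun, this]
    · have := (hsep (Nat.pair n t)).2 (by simpa using h) (by simpa using h')
      simp [b, hχ, charFun, this]
  · rw [TuringReducible, RecursiveIn.iff_nat]
    have hor : Nat.RecursiveIn {(χ : ℕ →. ℕ)} (χ : ℕ →. ℕ) := .oracle _ rfl
    have hgχ := recursiveIn_comp hor (recursiveIn_primrec hg)
    have hstep : Nat.RecursiveIn {(χ : ℕ →. ℕ)}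
        (fun p => p.unpair.2 + 2 ^ p.unpair.1 * (1 - χ (g p)) : ℕ → ℕ) := by
      have h : Primrec fun z : ℕ => z.unpair.1.unpair.2 + 2 ^ z.unpair.1.unpair.1 * (1 - z.unpair.2) :=
        Primrec.nat_add.comp (Primrec.snd.comp (Primrec.unpair.comp (Primrec.fst.comp Primrec.unpair)))
          (Primrec.nat_mul.comp (primrec_two_pow (Primrec.fst.comp (Primrec.unpair.comp
            (Primrec.fst.comp Primrec.unpair)))) (Primrec.nat_sub.comp (Primrec.const 1)
              (Primrec.snd.comp Primrec.unpair)))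
      have := recursiveIn_comp (recursiveIn_primrec h)
        (recursiveIn_pair (recursiveIn_primrec Primrec.id) hgχ)
      simpa using this
    have hpath : Nat.RecursiveIn {(χ : ℕ →. ℕ)} (pathApprox b : ℕ → ℕ) := by
      have := recursiveIn_rec hstep 0
      simp only [Nat.unpair_pair] at this
      exact this
    have hfin : Primrec fun z : ℕ => (z.unpair.2.testBit z.unpair.1).toNat :=
      (Primrec.dom_bool Bool.toNat).comp (primrec₂_testBit.comp (Primrec.snd.comp Primrec.unpair)
        (Primrec.fst.comp Primrec.unpair))
    have := recursiveIn_comp (recursiveIn_primrec hfin) (recursiveIn_pair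
      (recursiveIn_primrec Primrec.id) (recursiveIn_comp hpath (recursiveIn_primrec Primrec.succ)))
    simpa using this

end Relative

/-! ### Codes of schematic formulas -/

section Codes

/-- The number `m` is the code of a schematic formula in the variables `0, …, n - 1`, which is
equality-free unless `b` is true. -/
def IsCode (b : Bool) (m n : ℕ) : Prop :=
  ∃ φ : schematic.BoundedFormula Empty n, (b = true ∨ EqualityFree φ) ∧
    schematicEffective.formulaCode φ = m

lemma exists_eq_var {n : ℕ} (t : schematic.Term (Empty ⊕ Fin n)) : ∃ i : Fin n, t = .var (.inr i) := by
  rcases t with (e | i) | f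
  · exact e.elim
  · exact ⟨i, rfl⟩
  · exact f.elim

lemma termCode_var {n : ℕ} (i : Fin n) :
    schematicEffective.termCode (.var (.inr i) : schematic.Term (Empty ⊕ Fin n)) = Nat.pair 0 i := by
  simp [EffectiveLanguage.termCode]

/-- The atomic formula `X^l_c (x_{f 0}, …, x_{f (l - 1)})`. -/
def atom {n l : ℕ} (c : ℕ) (f : Fin l → Fin n) : schematic.BoundedFormula Empty n :=
  BoundedFormula.rel (L := schematic) (l := l) c fun i => .var (.inr (f i))

lemma exists_eq_atom {n l : ℕ} (c : schematic.Relations l)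
    (ts : Fin l → schematic.Term (Empty ⊕ Fin n)) :
    ∃ f : Fin l → Fin n, BoundedFormula.rel c ts = atom c f := by
  choose f hf using fun i => exists_eq_var (ts i)
  exact ⟨f, congrArg _ (funext hf)⟩

lemma formulaCode_atom {n l : ℕ} (c : ℕ) (f : Fin l → Fin n) :
    schematicEffective.formulaCode (atom c f) = Nat.pair 2 (Nat.pair (Nat.pair l c)
      (Encodable.encode (List.ofFn fun i => Nat.pair 0 (f i)))) := by
  simp only [atom, EffectiveLanguage.formulaCode, termCode_var]
  rfl

variable {b : Bool} {n : ℕ}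

/-- The facts from here to the end of the section, according to the leading tag of the code, match
the `code_` conditions of `Coherent`. They determine well-formedness by recursion, so it can be
carried as part of the diagram and need not be shown primitive recursive. -/
lemma isCode_falsum : IsCode b (Nat.pair 0 0) n := ⟨.falsum, .inr trivial, rfl⟩

lemma isCode_imp {a a' : ℕ} :
    IsCode b (Nat.pair 3 (Nat.pair a a')) n ↔ IsCode b a n ∧ IsCode b a' n := by
  constructor
  · rintro ⟨φ, hb, h⟩
    cases φ with
    | imp φ ψ =>
      simp only [EffectiveLanguage.formulaCode, Nat.pair_eq_pair, true_and] at h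
      exact ⟨⟨φ, hb.imp_right And.left, h.1⟩, ⟨ψ, hb.imp_right And.right, h.2⟩⟩
    | _ => simp [EffectiveLanguage.formulaCode, Nat.pair_eq_pair] at h
  · rintro ⟨⟨φ, hb, rfl⟩, ⟨ψ, hb', rfl⟩⟩
    refine ⟨.imp φ ψ, ?_, rfl⟩
    rcases hb with hb | hb
    · exact .inl hb
    · exact hb'.imp_right fun h => ⟨hb, h⟩

lemma isCode_all {a : ℕ} : IsCode b (Nat.pair 4 a) n ↔ IsCode b a (n + 1) := by
  constructor
  · rintro ⟨φ, hb, h⟩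
    cases φ with
    | all φ =>
      simp only [EffectiveLanguage.formulaCode, Nat.pair_eq_pair, true_and] at h
      exact ⟨φ, hb, h⟩
    | _ => simp [EffectiveLanguage.formulaCode, Nat.pair_eq_pair] at h
  · rintro ⟨φ, hb, rfl⟩
    exact ⟨.all φ, hb, rfl⟩

/-- The number codes a variable among `0, …, n - 1`. -/
def IsVarCode (n t : ℕ) : Prop := t.unpair.1 = 0 ∧ t.unpair.2 < n

lemma IsVarCode.exists_eq {t : ℕ} (h : IsVarCode n t) : ∃ i : Fin n, t = Nat.pair 0 i :=
  ⟨⟨_, h.2⟩, (Nat.pair_unpair t).symm.trans (congrArg (Nat.pair · _) h.1)⟩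

lemma isVarCode_pair (i : Fin n) : IsVarCode n (Nat.pair 0 i) := by
  simp [IsVarCode]

lemma isCode_equal {s t : ℕ} : IsCode b (Nat.pair 1 (Nat.pair s t)) n ↔
    b = true ∧ IsVarCode n s ∧ IsVarCode n t := by
  constructor
  · rintro ⟨φ, hb, h⟩
    cases φ with
    | equal s t =>
      simp only [EffectiveLanguage.formulaCode, Nat.pair_eq_pair, true_and] at h
      obtain ⟨i, rfl⟩ := exists_eq_var s
      obtain ⟨j, rfl⟩ := exists_eq_var t
      rw [termCode_var, termCode_var] at h
      obtain ⟨rfl, rfl⟩ := h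
      exact ⟨hb.resolve_right id, isVarCode_pair i, isVarCode_pair j⟩
    | _ => simp [EffectiveLanguage.formulaCode, Nat.pair_eq_pair] at h
  · rintro ⟨hb, hs, ht⟩
    obtain ⟨i, rfl⟩ := hs.exists_eq
    obtain ⟨j, rfl⟩ := ht.exists_eq
    exact ⟨.equal (.var (.inr i)) (.var (.inr j)), .inl hb, by
      simp [EffectiveLanguage.formulaCode, termCode_var]⟩

lemma isCode_rel {l c : ℕ} {U : List ℕ} :
    IsCode b (Nat.pair 2 (Nat.pair (Nat.pair l c) (Encodable.encode U))) n ↔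
      U.length = l ∧ ∀ t ∈ U, IsVarCode n t := by
  constructor
  · rintro ⟨φ, hb, h⟩
    cases φ with
    | @rel _ l' c' ts =>
      obtain ⟨f, hf⟩ := exists_eq_atom c' ts
      rw [hf] at h
      replace h := (formulaCode_atom c' f).symm.trans h
      obtain ⟨h₁, h₂⟩ := Nat.pair_eq_pair.1 (Nat.pair_eq_pair.1 h).2
      obtain rfl := (Nat.pair_eq_pair.1 h₁).1
      obtain rfl := Encodable.encode_injective h₂
      simp [List.mem_ofFn, isVarCode_pair]
    | _ => simp [EffectiveLanguage.formulaCode, Nat.pair_eq_pair] at h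
  · rintro ⟨rfl, h⟩
    choose f hf using fun i : Fin U.length => (h U[i] (List.getElem_mem _)).exists_eq
    refine ⟨atom c f, .inr trivial, ?_⟩
    rw [formulaCode_atom]
    simp only [← hf]
    congr
    exact List.ofFn_getElem

lemma not_isCode_zero_succ {r : ℕ} : ¬ IsCode b (Nat.pair 0 (r + 1)) n := by
  rintro ⟨φ, -, h⟩
  cases φ <;> simp [EffectiveLanguage.formulaCode, Nat.pair_eq_pair] at h

lemma not_isCode_add_five {t r : ℕ} : ¬ IsCode b (Nat.pair (t + 5) r) n := by
  rintro ⟨φ, -, h⟩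
  cases φ <;> simp only [EffectiveLanguage.formulaCode, Nat.pair_eq_pair] at h <;> omega

end Codes

/-! ### Effectively closed classes -/

section Clauses

/-- The class of truth assignments is given by a primitive recursive sequence of clauses. -/
def IsClauseClass {I : Type} [Primcodable I] (P : (I → Bool) → Prop) : Prop :=
  ∃ cl : ℕ → List (I × Bool), Primrec cl ∧ ∀ X, P X ↔ ∀ n, ∃ q ∈ cl n, X q.1 = q.2

variable {I C : Type} [Primcodable I] [Primcodable C] {P Q : (I → Bool) → Prop}

lemma IsClauseClass.of_iff (hP : IsClauseClass P) (h : ∀ X, P X ↔ Q X) : IsClauseClass Q :=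
  (funext fun X => propext (h X) : P = Q) ▸ hP

lemma isClauseClass_forall [Inhabited I] {cl : C → List (I × Bool)} (hcl : Primrec cl) :
    IsClauseClass fun X => ∀ c, ∃ q ∈ cl c, X q.1 = q.2 := by
  -- Numbers that code no index receive a tautology about the default place.
  refine ⟨fun n => (Encodable.decode (α := C) n).elim [(default, true), (default, false)] cl,
    ?_, fun X => ⟨fun h n => ?_, fun h c => ?_⟩⟩
  · refine (Primrec.option_casesOn (Primrec.decode (α := C)) (Primrec.const
      [((default : I), true), (default, false)]) (hcl.comp Primrec.snd).to₂).of_eq fun n => ?_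
    cases Encodable.decode (α := C) n <;> rfl
  · dsimp only
    cases hn : Encodable.decode (α := C) n with
    | none => cases hX : X default <;> simp [Option.elim, hX]
    | some c => exact h c
  · simpa using h (Encodable.encode c)

lemma IsClauseClass.and (hP : IsClauseClass P) (hQ : IsClauseClass Q) :
    IsClauseClass fun X => P X ∧ Q X := by
  obtain ⟨cl, hcl, h⟩ := hP
  obtain ⟨cl', hcl', h'⟩ := hQ
  refine ⟨fun n => bif n.bodd then cl n.div2 else cl' n.div2, ?_, fun X => ?_⟩
  · exact Primrec.cond Primrec.nat_bodd (hcl.comp Primrec.nat_div2) (hcl'.comp Primrec.nat_div2)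
  · refine (and_congr (h X) (h' X)).trans ?_
    constructor
    · rintro ⟨h1, h2⟩ n
      cases hn : n.bodd
      · simpa [hn] using h2 n.div2
      · simpa [hn] using h1 n.div2
    · refine fun H => ⟨fun n => ?_, fun n => ?_⟩
      · simpa using H (2 * n + 1)
      · simpa using H (2 * n)

lemma isClauseClass_eq [Inhabited I] {i : C → I} {f : C → Bool} (hi : Primrec i) (hf : Primrec f) :
    IsClauseClass fun X => ∀ c, X (i c) = f c :=
  (isClauseClass_forall (cl := fun c => [(i c, f c)])
    (Primrec.list_cons.comp (Primrec.pair hi hf) (Primrec.const []))).of_iff fun X => by simp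

/-- There is one clause for each guess `x`, `y` of the two inputs: a guess is wrong, or the output
is `F x y`. The list `G` adds alternatives that excuse the identity. When `F` ignores its second
input, any place serves as `k`. -/
lemma isClauseClass_bool [Inhabited I] (F : Bool → Bool → Bool) {G : C → List (I × Bool)}
    {i j k : C → I} (hG : Primrec G) (hi : Primrec i) (hj : Primrec j) (hk : Primrec k) :
    IsClauseClass fun X => ∀ c, (∃ q ∈ G c, X q.1 = q.2) ∨ X (i c) = F (X (j c)) (X (k c)) := by
  have hF : Primrec fun p : Bool × Bool => F p.1 p.2 := Primrec.dom_finite _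
  have h : Primrec fun p : C × Bool × Bool => (j p.1, !p.2.1) :: (k p.1, !p.2.2) ::
      (i p.1, F p.2.1 p.2.2) :: G p.1 :=
    Primrec.list_cons.comp (Primrec.pair (hj.comp Primrec.fst)
      (Primrec.not.comp (Primrec.fst.comp Primrec.snd)))
      (Primrec.list_cons.comp (Primrec.pair (hk.comp Primrec.fst)
        (Primrec.not.comp (Primrec.snd.comp Primrec.snd)))
        (Primrec.list_cons.comp (Primrec.pair (hi.comp Primrec.fst) (hF.comp Primrec.snd))
          (hG.comp Primrec.fst)))
  refine (isClauseClass_forall h).of_iff fun X => ⟨fun H c => ?_, ?_⟩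
  · simpa [or_comm] using H (c, X (j c), X (k c))
  · rintro H ⟨c, x, y⟩
    rcases H c with ⟨q, hq, hX⟩ | hc
    · exact ⟨q, by simp [hq], hX⟩
    · by_cases hx : X (j c) = x
      · by_cases hy : X (k c) = y
        · exact ⟨(i c, F x y), by simp, by rw [hc, hx, hy]⟩
        · exact ⟨(k c, !y), by simp, Bool.eq_not.2 hy⟩
      · exact ⟨(j c, !x), by simp, Bool.eq_not.2 hx⟩

end Clauses

/-! ### The class of diagrams -/

section Diagram

/-- The places of a diagram: well-formedness of codes, atomic facts, satisfaction, validity. -/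
abbrev Place : Type := (Bool × ℕ × ℕ) ⊕ (ℕ × List ℕ) ⊕ (ℕ × List ℕ × (ℕ ⊕ List ℕ)) ⊕ ℕ

/-- The place for `m` being the code of a formula in `n` variables. -/
def pCode (b : Bool) (m n : ℕ) : Place := .inl (b, m, n)

/-- The place for the tuple `x` being in the relation named by the symbol `c`. -/
def pRel (c : ℕ) (x : List ℕ) : Place := .inr (.inl (c, x))

/-- The place for the formula with code `m` being true at `v`, where the relation symbols are
interpreted according to `p`: shifted if `p` is `.inl e`, and by formulas if `p` is `.inr ps`. -/
def pSat (m : ℕ) (v : List ℕ) (p : ℕ ⊕ List ℕ) : Place := .inr (.inr (.inl (m, v, p)))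

/-- The place for the sentence with code `m` being a validity. -/
def pVal (m : ℕ) : Place := .inr (.inr (.inr m))

/-- The `e`-th renaming of relation symbols; the renaming number `0` is the identity. -/
def shift (e c : ℕ) : ℕ := if e = 0 then c else Nat.pair e c

/-- The code of the atomic formula whose symbol is `c` and whose variables are listed. -/
def atomCode (c : ℕ) (is : List ℕ) : ℕ :=
  Nat.pair 2 (Nat.pair (Nat.pair is.length c) (Encodable.encode (is.map (Nat.pair 0))))

/-- The entries of `v` at the places in the list. -/
def entries (v is : List ℕ) : List ℕ := is.map fun i => v.getD i 0

/-- A bound for the element that refutes a universal formula. -/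
def witnessBound (a : ℕ) (v : List ℕ) (p : ℕ ⊕ List ℕ) : ℕ := 2 * Encodable.encode (a, v, p) + 2

instance (n t : ℕ) : Decidable (IsVarCode n t) := inferInstanceAs (Decidable (_ ∧ _))

/-- The assignment is the diagram of a structure on the natural numbers, with its satisfaction
relation and the set of its validities. -/
structure Coherent (X : Place → Bool) : Prop where
  code_falsum : ∀ b n, X (pCode b (Nat.pair 0 0) n) = true
  code_zero_succ : ∀ b r n, X (pCode b (Nat.pair 0 (r + 1)) n) = false
  code_equal : ∀ b s t n, X (pCode b (Nat.pair 1 (Nat.pair s t)) n) =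
    decide (b = true ∧ IsVarCode n s ∧ IsVarCode n t)
  code_rel : ∀ b l c (U : List ℕ) n,
    X (pCode b (Nat.pair 2 (Nat.pair (Nat.pair l c) (Encodable.encode U))) n) =
      decide (U.length = l ∧ ∀ t ∈ U, IsVarCode n t)
  code_imp : ∀ b a a' n, X (pCode b (Nat.pair 3 (Nat.pair a a')) n) =
    (X (pCode b a n) && X (pCode b a' n))
  code_all : ∀ b a n, X (pCode b (Nat.pair 4 a) n) = X (pCode b a (n + 1))
  code_add_five : ∀ b t r n, X (pCode b (Nat.pair (t + 5) r) n) = false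
  sat_falsum : ∀ v p, X (pSat (Nat.pair 0 0) v p) = false
  sat_equal : ∀ i j v p, X (pSat (Nat.pair 1 (Nat.pair (Nat.pair 0 i) (Nat.pair 0 j))) v p) =
    decide (i < v.length ∧ j < v.length ∧ v.getD i 0 = v.getD j 0)
  sat_atom_shift : ∀ c is v e, X (pCode true (atomCode c is) v.length) = false ∨
    X (pSat (atomCode c is) v (.inl e)) = X (pRel (shift e c) (entries v is))
  -- A missing entry of `ps` reads 0, which is `Nat.pair 0 0`, the code of falsum.
  sat_atom_subst : ∀ c is v ps, X (pCode true (atomCode c is) v.length) = false ∨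
    X (pSat (atomCode c is) v (.inr ps)) =
      X (pSat (ps.getD (Nat.pair is.length c) 0) (entries v is) (.inl 0))
  -- The guards are needed because satisfaction is to be false at numbers that code no formula,
  -- where this recursion would fail.
  sat_imp : ∀ a a' v p, X (pCode true a v.length) = false ∨ X (pCode true a' v.length) = false ∨
    X (pSat (Nat.pair 3 (Nat.pair a a')) v p) = (!X (pSat a v p) || X (pSat a' v p))
  sat_all : ∀ a v p x, X (pCode true a (v.length + 1)) = false ∨
    X (pSat (Nat.pair 4 a) v p) = false ∨ X (pSat a (v ++ [x]) p) = true
  -- The bound turns the existence of a counterexample into a finite disjunction, hence into a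
  -- clause.
  sat_witness : ∀ a v p, X (pCode true a (v.length + 1)) = false ∨
    X (pSat (Nat.pair 4 a) v p) = true ∨ ∃ x < witnessBound a v p, X (pSat a (v ++ [x]) p) = false
  -- These predicates on the even numbers are what prevents categoricity.
  rel_testBit : ∀ i k, X (pRel (Nat.pair 0 i) [2 * k]) = k.testBit i
  sat_code : ∀ m, X (pSat m [] (.inl 0)) = false ∨ X (pCode true m 0) = true
  val_code : ∀ m, X (pVal m) = false ∨ X (pCode false m 0) = true
  val_inst : ∀ m ps, X (pVal m) = false ∨ X (pSat m [] (.inr ps)) = true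
  -- Failure of validity shows up in one prescribed instance: the renaming into the copy numbered `m
  -- + 1`, the number 0 being reserved for the identity renaming.
  val_of_sat : ∀ m, X (pVal m) = true ∨ X (pCode false m 0) = false ∨
    X (pSat m [] (.inl (m + 1))) = false

/-! ### Primitive recursiveness of places and clauses -/

section Primrec

variable {C : Type} [Primcodable C]

lemma primrec_pCode {b : C → Bool} {m n : C → ℕ} (hb : Primrec b) (hm : Primrec m)
    (hn : Primrec n) : Primrec fun c => pCode (b c) (m c) (n c) :=
  Primrec.sumInl.comp (hb.pair (hm.pair hn))

lemma primrec_pRel {s : C → ℕ} {x : C → List ℕ} (hs : Primrec s) (hx : Primrec x) :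
    Primrec fun c => pRel (s c) (x c) :=
  Primrec.sumInr.comp (Primrec.sumInl.comp (hs.pair hx))

lemma primrec_pSat {m : C → ℕ} {v : C → List ℕ} {p : C → ℕ ⊕ List ℕ} (hm : Primrec m)
    (hv : Primrec v) (hp : Primrec p) : Primrec fun c => pSat (m c) (v c) (p c) :=
  Primrec.sumInr.comp (Primrec.sumInr.comp (Primrec.sumInl.comp (hm.pair (hv.pair hp))))

lemma primrec_pVal {m : C → ℕ} (hm : Primrec m) : Primrec fun c => pVal (m c) :=
  Primrec.sumInr.comp (Primrec.sumInr.comp (Primrec.sumInr.comp hm))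

lemma primrec_shift {e s : C → ℕ} (he : Primrec e) (hs : Primrec s) :
    Primrec fun c => shift (e c) (s c) :=
  Primrec.ite (Primrec.eq.comp he (Primrec.const 0)) hs (Primrec₂.natPair.comp he hs)

lemma primrec_atomCode {s : C → ℕ} {is : C → List ℕ} (hs : Primrec s) (his : Primrec is) :
    Primrec fun c => atomCode (s c) (is c) :=
  Primrec₂.natPair.comp (Primrec.const 2) (Primrec₂.natPair.comp
    (Primrec₂.natPair.comp (Primrec.list_length.comp his) hs)
    (Primrec.encode.comp (Primrec.list_map his
      (Primrec₂.natPair.comp (Primrec.const 0) Primrec.snd))))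

lemma primrec_entries {v is : C → List ℕ} (hv : Primrec v) (his : Primrec is) :
    Primrec fun c => entries (v c) (is c) :=
  Primrec.list_map his ((Primrec.list_getD 0).comp (hv.comp Primrec.fst) Primrec.snd)

lemma primrec_witnessBound {a : C → ℕ} {v : C → List ℕ} {p : C → ℕ ⊕ List ℕ} (ha : Primrec a)
    (hv : Primrec v) (hp : Primrec p) : Primrec fun c => witnessBound (a c) (v c) (p c) :=
  Primrec.nat_add.comp (Primrec.nat_mul.comp (Primrec.const 2)
    (Primrec.encode.comp (ha.pair (hv.pair hp)))) (Primrec.const 2)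

lemma primrec_snoc {v : C → List ℕ} {x : C → ℕ} (hv : Primrec v) (hx : Primrec x) :
    Primrec fun c => v c ++ [x c] :=
  Primrec.list_append.comp hv (Primrec.list_cons.comp hx (Primrec.const []))

lemma primrecRel_isVarCode : PrimrecRel IsVarCode :=
  PrimrecPred.and (Primrec.eq.comp (Primrec.fst.comp (Primrec.unpair.comp Primrec.snd))
    (Primrec.const 0)) (Primrec.nat_lt.comp (Primrec.snd.comp (Primrec.unpair.comp Primrec.snd))
      Primrec.fst)

lemma primrec_lit {i : C → Place} (hi : Primrec i) (b : Bool) :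
    Primrec fun c => ((i c, b) : Place × Bool) := hi.pair (Primrec.const b)

lemma primrec_clause₁ {f : C → Place × Bool} (hf : Primrec f) : Primrec fun c => [f c] :=
  Primrec.list_cons.comp hf (Primrec.const [])

lemma primrec_clause₂ {f g : C → Place × Bool} (hf : Primrec f) (hg : Primrec g) :
    Primrec fun c => [f c, g c] :=
  Primrec.list_cons.comp hf (primrec_clause₁ hg)

lemma primrec_clause₃ {f g h : C → Place × Bool} (hf : Primrec f) (hg : Primrec g)
    (hh : Primrec h) : Primrec fun c => [f c, g c, h c] :=
  Primrec.list_cons.comp hf (primrec_clause₂ hg hh)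

end Primrec

/-! ### Coherence as an effectively closed condition -/

section Families

variable {α β γ δ ε : Type} [Primcodable α] [Primcodable β] [Primcodable γ] [Primcodable δ]
  [Primcodable ε]

lemma primrec_proj₂ : Primrec fun c : α × β × γ => c.2.1 := Primrec.fst.comp Primrec.snd
lemma primrec_proj₂' : Primrec fun c : α × β × γ => c.2.2 := Primrec.snd.comp Primrec.snd
lemma primrec_proj₃ : Primrec fun c : α × β × γ × δ => c.2.2.1 := Primrec.fst.comp primrec_proj₂'
lemma primrec_proj₃' : Primrec fun c : α × β × γ × δ => c.2.2.2 := Primrec.snd.comp primrec_proj₂'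
lemma primrec_proj₄ : Primrec fun c : α × β × γ × δ × ε => c.2.2.2.1 :=
  Primrec.fst.comp primrec_proj₃'
lemma primrec_proj₄' : Primrec fun c : α × β × γ × δ × ε => c.2.2.2.2 :=
  Primrec.snd.comp primrec_proj₃'

open Primrec in
lemma isClauseClass_code : IsClauseClass fun X : Place → Bool =>
    ((∀ b n, X (pCode b (Nat.pair 0 0) n) = true) ∧
    (∀ b r n, X (pCode b (Nat.pair 0 (r + 1)) n) = false) ∧
    (∀ b s t n, X (pCode b (Nat.pair 1 (Nat.pair s t)) n) =
      decide (b = true ∧ IsVarCode n s ∧ IsVarCode n t)) ∧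
    (∀ b l c (U : List ℕ) n,
      X (pCode b (Nat.pair 2 (Nat.pair (Nat.pair l c) (Encodable.encode U))) n) =
        decide (U.length = l ∧ ∀ t ∈ U, IsVarCode n t)) ∧
    (∀ b a a' n, X (pCode b (Nat.pair 3 (Nat.pair a a')) n) =
      (X (pCode b a n) && X (pCode b a' n))) ∧
    (∀ b a n, X (pCode b (Nat.pair 4 a) n) = X (pCode b a (n + 1))) ∧
    (∀ b t r n, X (pCode b (Nat.pair (t + 5) r) n) = false)) := by
  refine .and ?_ (.and ?_ (.and ?_ (.and ?_ (.and ?_ (.and ?_ ?_)))))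
  · exact (isClauseClass_eq (C := Bool × ℕ) (primrec_pCode fst (const (Nat.pair 0 0)) snd)
      (const true)).of_iff fun X => Prod.forall
  · exact (isClauseClass_eq (C := Bool × ℕ × ℕ) (primrec_pCode fst
      (Primrec₂.natPair.comp (const 0) (succ.comp primrec_proj₂)) primrec_proj₂')
      (const false)).of_iff fun X => by simp only [Prod.forall]
  · refine (isClauseClass_eq (C := Bool × ℕ × ℕ × ℕ) (primrec_pCode fst
      (Primrec₂.natPair.comp (const 1) (Primrec₂.natPair.comp primrec_proj₂ primrec_proj₃))
      primrec_proj₃') (f := fun c => decide (c.1 = true ∧ IsVarCode c.2.2.2 c.2.1 ∧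
        IsVarCode c.2.2.2 c.2.2.1)) ?_).of_iff fun X => by simp only [Prod.forall]
    exact PrimrecPred.decide (PrimrecPred.and (Primrec.eq.comp fst (const true))
      (PrimrecPred.and (primrecRel_isVarCode.comp primrec_proj₃' primrec_proj₂)
        (primrecRel_isVarCode.comp primrec_proj₃' primrec_proj₃)))
  · refine (isClauseClass_eq (C := Bool × ℕ × ℕ × List ℕ × ℕ) (primrec_pCode fst
      (Primrec₂.natPair.comp (const 2) (Primrec₂.natPair.comp (Primrec₂.natPair.comp
        primrec_proj₂ primrec_proj₃) (Primrec.encode.comp primrec_proj₄)))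
      primrec_proj₄') (f := fun c => decide (c.2.2.2.1.length = c.2.1 ∧
        ∀ t ∈ c.2.2.2.1, IsVarCode c.2.2.2.2 t)) ?_).of_iff fun X => by simp only [Prod.forall]
    have h : PrimrecRel fun t n => IsVarCode n t := primrecRel_isVarCode.comp snd fst
    exact PrimrecPred.decide (PrimrecPred.and
      (Primrec.eq.comp (list_length.comp primrec_proj₄) primrec_proj₂)
      (h.forall_mem_list.comp primrec_proj₄ primrec_proj₄'))
  · exact (isClauseClass_bool (C := Bool × ℕ × ℕ × ℕ) (fun x y => x && y) (const []) (primrec_pCode fst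
      (Primrec₂.natPair.comp (const 3) (Primrec₂.natPair.comp primrec_proj₂ primrec_proj₃))
      primrec_proj₃') (primrec_pCode fst primrec_proj₂ primrec_proj₃')
      (primrec_pCode fst primrec_proj₃ primrec_proj₃')).of_iff fun X => by
        simp [Prod.forall]
  · exact (isClauseClass_bool (C := Bool × ℕ × ℕ) (fun x _ => x) (const []) (primrec_pCode fst
      (Primrec₂.natPair.comp (const 4) primrec_proj₂) primrec_proj₂')
      (primrec_pCode fst primrec_proj₂ (succ.comp primrec_proj₂'))
      (const (pVal 0))).of_iff fun X => by simp [Prod.forall]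
  · exact (isClauseClass_eq (C := Bool × ℕ × ℕ × ℕ) (primrec_pCode fst
      (Primrec₂.natPair.comp (nat_add.comp primrec_proj₂ (const 5)) primrec_proj₃) primrec_proj₃')
      (const false)).of_iff fun X => by simp only [Prod.forall]

open Primrec in
lemma isClauseClass_sat : IsClauseClass fun X : Place → Bool =>
    ((∀ v p, X (pSat (Nat.pair 0 0) v p) = false) ∧
    (∀ i j v p, X (pSat (Nat.pair 1 (Nat.pair (Nat.pair 0 i) (Nat.pair 0 j))) v p) =
      decide (i < v.length ∧ j < v.length ∧ v.getD i 0 = v.getD j 0)) ∧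
    (∀ c is v e, X (pCode true (atomCode c is) v.length) = false ∨
      X (pSat (atomCode c is) v (.inl e)) = X (pRel (shift e c) (entries v is))) ∧
    (∀ c is v ps, X (pCode true (atomCode c is) v.length) = false ∨
      X (pSat (atomCode c is) v (.inr ps)) =
        X (pSat (ps.getD (Nat.pair is.length c) 0) (entries v is) (.inl 0))) ∧
    (∀ a a' v p, X (pCode true a v.length) = false ∨ X (pCode true a' v.length) = false ∨
      X (pSat (Nat.pair 3 (Nat.pair a a')) v p) = (!X (pSat a v p) || X (pSat a' v p))) ∧
    (∀ a v p x, X (pCode true a (v.length + 1)) = false ∨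
      X (pSat (Nat.pair 4 a) v p) = false ∨ X (pSat a (v ++ [x]) p) = true) ∧
    (∀ a v p, X (pCode true a (v.length + 1)) = false ∨ X (pSat (Nat.pair 4 a) v p) = true ∨
      ∃ x < witnessBound a v p, X (pSat a (v ++ [x]) p) = false)) := by
  refine .and ?_ (.and ?_ (.and ?_ (.and ?_ (.and ?_ (.and ?_ ?_)))))
  · exact (isClauseClass_eq (C := List ℕ × (ℕ ⊕ List ℕ))
      (primrec_pSat (const (Nat.pair 0 0)) fst snd) (const false)).of_iff fun X => Prod.forall
  · refine (isClauseClass_eq (C := ℕ × ℕ × List ℕ × (ℕ ⊕ List ℕ))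
      (primrec_pSat (Primrec₂.natPair.comp (const 1) (Primrec₂.natPair.comp
        (Primrec₂.natPair.comp (const 0) fst) (Primrec₂.natPair.comp (const 0) primrec_proj₂)))
        primrec_proj₃ primrec_proj₃') (f := fun c => decide (c.1 < c.2.2.1.length ∧
          c.2.1 < c.2.2.1.length ∧ c.2.2.1.getD c.1 0 = c.2.2.1.getD c.2.1 0))
        ?_).of_iff fun X => by simp only [Prod.forall]
    exact PrimrecPred.decide (PrimrecPred.and (nat_lt.comp fst (list_length.comp primrec_proj₃))
      (PrimrecPred.and (nat_lt.comp primrec_proj₂ (list_length.comp primrec_proj₃))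
        (Primrec.eq.comp ((list_getD 0).comp primrec_proj₃ fst)
          ((list_getD 0).comp primrec_proj₃ primrec_proj₂))))
  · exact (isClauseClass_bool (C := ℕ × List ℕ × List ℕ × ℕ) (fun x _ => x)
      (primrec_clause₁ (primrec_lit (primrec_pCode (const true) (primrec_atomCode fst primrec_proj₂)
        (list_length.comp primrec_proj₃)) false))
      (primrec_pSat (primrec_atomCode fst primrec_proj₂) primrec_proj₃
        (sumInl.comp primrec_proj₃'))
      (primrec_pRel (primrec_shift primrec_proj₃' fst) (primrec_entries primrec_proj₃ primrec_proj₂))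
      (const (pVal 0))).of_iff fun X => by simp [Prod.forall]
  · exact (isClauseClass_bool (C := ℕ × List ℕ × List ℕ × List ℕ) (fun x _ => x)
      (primrec_clause₁ (primrec_lit (primrec_pCode (const true) (primrec_atomCode fst primrec_proj₂)
        (list_length.comp primrec_proj₃)) false))
      (primrec_pSat (primrec_atomCode fst primrec_proj₂) primrec_proj₃
        (sumInr.comp primrec_proj₃'))
      (primrec_pSat ((list_getD 0).comp primrec_proj₃' (Primrec₂.natPair.comp
        (list_length.comp primrec_proj₂) fst)) (primrec_entries primrec_proj₃ primrec_proj₂)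
        (const (.inl 0)))
      (const (pVal 0))).of_iff fun X => by simp [Prod.forall]
  · exact (isClauseClass_bool (C := ℕ × ℕ × List ℕ × (ℕ ⊕ List ℕ)) (fun x y => !x || y)
      (primrec_clause₂ (primrec_lit (primrec_pCode (const true) fst
        (list_length.comp primrec_proj₃)) false) (primrec_lit (primrec_pCode (const true)
          primrec_proj₂ (list_length.comp primrec_proj₃)) false))
      (primrec_pSat (Primrec₂.natPair.comp (const 3) (Primrec₂.natPair.comp fst primrec_proj₂))
        primrec_proj₃ primrec_proj₃')
      (primrec_pSat fst primrec_proj₃ primrec_proj₃')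
      (primrec_pSat primrec_proj₂ primrec_proj₃ primrec_proj₃')).of_iff fun X => by
        simp [Prod.forall, or_assoc]
  · exact (isClauseClass_forall (C := ℕ × List ℕ × (ℕ ⊕ List ℕ) × ℕ) (primrec_clause₃
      (primrec_lit (primrec_pCode (const true) fst (succ.comp (list_length.comp primrec_proj₂))) false)
      (primrec_lit (primrec_pSat (Primrec₂.natPair.comp (const 4) fst) primrec_proj₂
        primrec_proj₃) false)
      (primrec_lit (primrec_pSat fst (primrec_snoc primrec_proj₂ primrec_proj₃') primrec_proj₃)
        true))).of_iff fun X => by simp [Prod.forall]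
  · have h : Primrec fun c : ℕ × List ℕ × (ℕ ⊕ List ℕ) =>
        (pCode true c.1 (c.2.1.length + 1), false) :: (pSat (Nat.pair 4 c.1) c.2.1 c.2.2, true) ::
          (List.range (witnessBound c.1 c.2.1 c.2.2)).map
            fun x => (pSat c.1 (c.2.1 ++ [x]) c.2.2, false) := by
      refine list_cons.comp (primrec_lit (primrec_pCode (const true) fst
        (succ.comp (list_length.comp primrec_proj₂))) false) (list_cons.comp (primrec_lit
          (primrec_pSat (Primrec₂.natPair.comp (const 4) fst) primrec_proj₂ primrec_proj₂') true)
          (list_map (list_range.comp (primrec_witnessBound fst primrec_proj₂ primrec_proj₂')) ?_))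
      exact primrec_lit (primrec_pSat (fst.comp fst) (primrec_snoc (primrec_proj₂.comp fst) snd)
        (primrec_proj₂'.comp fst)) false
    exact (isClauseClass_forall h).of_iff fun X => by simp [Prod.forall]

open Primrec in
lemma isClauseClass_val : IsClauseClass fun X : Place → Bool =>
    ((∀ i k, X (pRel (Nat.pair 0 i) [2 * k]) = k.testBit i) ∧
    (∀ m, X (pSat m [] (.inl 0)) = false ∨ X (pCode true m 0) = true) ∧
    (∀ m, X (pVal m) = false ∨ X (pCode false m 0) = true) ∧
    (∀ m ps, X (pVal m) = false ∨ X (pSat m [] (.inr ps)) = true) ∧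
    (∀ m, X (pVal m) = true ∨ X (pCode false m 0) = false ∨
      X (pSat m [] (.inl (m + 1))) = false)) := by
  refine .and ?_ (.and ?_ (.and ?_ (.and ?_ ?_)))
  · exact (isClauseClass_eq (C := ℕ × ℕ) (primrec_pRel (Primrec₂.natPair.comp (const 0) fst)
      (list_cons.comp (nat_mul.comp (const 2) snd) (const [])))
      (primrec₂_testBit.comp snd fst)).of_iff fun X => Prod.forall
  · exact (isClauseClass_forall (C := ℕ) (primrec_clause₂
      (primrec_lit (primrec_pSat .id (const []) (const (.inl 0))) false)
      (primrec_lit (primrec_pCode (const true) .id (const 0)) true))).of_iff fun X => by simp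
  · exact (isClauseClass_forall (C := ℕ) (primrec_clause₂ (primrec_lit (primrec_pVal .id) false)
      (primrec_lit (primrec_pCode (const false) .id (const 0)) true))).of_iff fun X => by simp
  · exact (isClauseClass_forall (C := ℕ × List ℕ) (primrec_clause₂
      (primrec_lit (primrec_pVal fst) false)
      (primrec_lit (primrec_pSat fst (const []) (sumInr.comp snd)) true))).of_iff fun X => by
        simp [Prod.forall]
  · exact (isClauseClass_forall (C := ℕ) (primrec_clause₃ (primrec_lit (primrec_pVal .id) true)
      (primrec_lit (primrec_pCode (const false) .id (const 0)) false)
      (primrec_lit (primrec_pSat .id (const []) (sumInl.comp succ)) false))).of_iff fun X => by simp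

theorem isClauseClass_coherent : IsClauseClass Coherent := by
  refine (isClauseClass_code.and (isClauseClass_sat.and isClauseClass_val)).of_iff fun X => ?_
  constructor
  · rintro ⟨⟨h1, h2, h3, h4, h5, h6, h7⟩, ⟨h8, h9, h10, h11, h12, h13, h14⟩,
      h15, h16, h17, h18, h19⟩
    exact ⟨h1, h2, h3, h4, h5, h6, h7, h8, h9, h10, h11, h12, h13, h14, h15, h16, h17, h18, h19⟩
  · rintro ⟨h1, h2, h3, h4, h5, h6, h7, h8, h9, h10, h11, h12, h13, h14, h15, h16, h17, h18, h19⟩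
    exact ⟨⟨h1, h2, h3, h4, h5, h6, h7⟩, ⟨h8, h9, h10, h11, h12, h13, h14⟩,
      h15, h16, h17, h18, h19⟩

end Families

end Diagram

/-! ### Truth in relational structures -/

section Holds

variable {M : Type}

/-- The structure for the schematic language with the given relations. -/
@[reducible] def relStructure (r : ∀ l : ℕ, ℕ → (Fin l → M) → Prop) : schematic.Structure M where
  funMap := fun f => Empty.elim f
  RelMap := fun {l} c x => r l c x

/-- The formula is true, at the given elements, in the structure with the given relations. -/
def Holds (r : ∀ l : ℕ, ℕ → (Fin l → M) → Prop) {n : ℕ} (φ : schematic.BoundedFormula Empty n)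
    (v : Fin n → M) : Prop :=
  letI := relStructure r
  φ.Realize default v

variable {r r' : ∀ l : ℕ, ℕ → (Fin l → M) → Prop} {n : ℕ} {v : Fin n → M}

lemma holds_falsum : ¬ Holds r (.falsum : schematic.BoundedFormula Empty n) v := id

lemma holds_equal (i j : Fin n) :
    Holds r (.equal (.var (.inr i)) (.var (.inr j))) v ↔ v i = v j := Iff.rfl

lemma holds_atom {l : ℕ} (c : ℕ) (f : Fin l → Fin n) : Holds r (atom c f) v ↔ r l c (v ∘ f) :=
  Iff.rfl

lemma holds_imp (φ ψ : schematic.BoundedFormula Empty n) :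
    Holds r (φ.imp ψ) v ↔ (Holds r φ v → Holds r ψ v) := Iff.rfl

lemma holds_all (φ : schematic.BoundedFormula Empty (n + 1)) :
    Holds r φ.all v ↔ ∀ x, Holds r φ (Fin.snoc v x) := Iff.rfl

/-- Induction on schematic formulas. -/
lemma schematic_induction {P : ∀ {n : ℕ}, schematic.BoundedFormula Empty n → Prop}
    (falsum : ∀ n, P (.falsum : schematic.BoundedFormula Empty n))
    (equal : ∀ (n : ℕ) (i j : Fin n), P (.equal (.var (.inr i)) (.var (.inr j))))
    (atom : ∀ (n l c : ℕ) (f : Fin l → Fin n), P (atom c f))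
    (imp : ∀ (n : ℕ) (φ ψ : schematic.BoundedFormula Empty n), P φ → P ψ → P (φ.imp ψ))
    (all : ∀ (n : ℕ) (φ : schematic.BoundedFormula Empty (n + 1)), P φ → P φ.all)
    {n : ℕ} (φ : schematic.BoundedFormula Empty n) : P φ := by
  induction φ with
  | falsum => exact falsum _
  | equal s t =>
    obtain ⟨i, rfl⟩ := exists_eq_var s
    obtain ⟨j, rfl⟩ := exists_eq_var t
    exact equal _ i j
  | rel c ts =>
    obtain ⟨f, hf⟩ := exists_eq_atom c ts
    rw [hf]
    exact atom _ _ _ f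
  | imp φ ψ ih ih' => exact imp _ _ _ ih ih'
  | all φ ih => exact all _ _ ih

lemma formulaCode_imp (φ ψ : schematic.BoundedFormula Empty n) :
    schematicEffective.formulaCode (φ.imp ψ) = Nat.pair 3
      (Nat.pair (schematicEffective.formulaCode φ) (schematicEffective.formulaCode ψ)) := rfl

lemma formulaCode_all (φ : schematic.BoundedFormula Empty (n + 1)) :
    schematicEffective.formulaCode φ.all = Nat.pair 4 (schematicEffective.formulaCode φ) := rfl

lemma formulaCode_equal (i j : Fin n) : schematicEffective.formulaCode
    (.equal (.var (.inr i)) (.var (.inr j)) : schematic.BoundedFormula Empty n) =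
      Nat.pair 1 (Nat.pair (Nat.pair 0 i) (Nat.pair 0 j)) := by
  simp only [EffectiveLanguage.formulaCode, termCode_var]

/-- The truth of a formula depends only on the symbols numbered below its code. -/
lemma holds_congr {N : ℕ} (hr : ∀ l c, Nat.pair l c < N → r l c = r' l c)
    (φ : schematic.BoundedFormula Empty n) (hφ : schematicEffective.formulaCode φ < N) :
    Holds r φ v ↔ Holds r' φ v := by
  induction φ using schematic_induction with
  | falsum => exact Iff.rfl
  | equal => exact Iff.rfl
  | atom n l c f =>
    rw [formulaCode_atom] at hφ
    rw [holds_atom, holds_atom, hr]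
    exact ((Nat.left_le_pair _ _).trans (Nat.right_le_pair _ _)).trans_lt hφ
  | imp n φ ψ ih ih' =>
    rw [formulaCode_imp] at hφ
    rw [holds_imp, holds_imp, ih, ih']
    · exact ((Nat.right_le_pair _ _).trans (Nat.right_le_pair _ _)).trans_lt hφ
    · exact ((Nat.left_le_pair _ _).trans (Nat.right_le_pair _ _)).trans_lt hφ
  | all n φ ih =>
    rw [formulaCode_all] at hφ
    rw [holds_all, holds_all]
    exact forall_congr' fun x => ih ((Nat.right_le_pair _ _).trans_lt hφ)

/-- Truth of a formula whose free variables are `0, …, l - 1`. -/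
def HoldsFormula (r : ∀ l : ℕ, ℕ → (Fin l → M) → Prop) {l : ℕ} (ψ : schematic.Formula (Fin l))
    (x : Fin l → M) : Prop :=
  letI := relStructure r
  ψ.Realize x

/-- Truth of a substitution instance is truth of the original sentence in the structure of the
defined relations. This turns validity into a statement about definable interpretations. -/
lemma holds_substitute (ψ : ∀ l : ℕ, ℕ → schematic.Formula (Fin l))
    (φ : schematic.BoundedFormula Empty n) :
    Holds r (substitute ψ φ) v ↔ Holds (fun l c x => HoldsFormula r (ψ l c) x) φ v := by
  induction φ using schematic_induction with
  | falsum => exact Iff.rfl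
  | equal => exact Iff.rfl
  | atom n l c f =>
    let := relStructure r
    rw [holds_atom]
    change BoundedFormula.Realize (BoundedFormula.relabel (n := n) (k := 0) (fun j => Sum.inr (f j)) (ψ l c))
      _ _ ↔ _
    rw [BoundedFormula.realize_relabel]
    refine iff_of_eq (congrArg₂ (fun w x => BoundedFormula.Realize (ψ l c) w x) rfl ?_)
    exact Subsingleton.elim (α := Fin 0 → M) _ _
  | imp n φ ψ ih ih' => exact imp_congr ih ih'
  | all n φ ih => exact forall_congr' fun x => ih

/-- The formula with free variables `0, …, l - 1` as a formula with bound variables. -/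
def toBound {l : ℕ} (ψ : schematic.Formula (Fin l)) : schematic.BoundedFormula Empty l :=
  BoundedFormula.relabel (n := l) Sum.inr ψ

lemma holds_toBound {l : ℕ} (ψ : schematic.Formula (Fin l)) (x : Fin l → M) :
    Holds r (toBound ψ) x ↔ HoldsFormula r ψ x := by
  let := relStructure r
  change BoundedFormula.Realize (BoundedFormula.relabel (n := l) (k := 0) Sum.inr ψ) _ _ ↔ _
  rw [BoundedFormula.realize_relabel]
  refine iff_of_eq (congrArg₂ (fun w x => BoundedFormula.Realize ψ w x) rfl ?_)
  exact Subsingleton.elim (α := Fin 0 → M) _ _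

/-- The formula with bound variables `0, …, l - 1` as a formula with free variables. -/
def ofBound {l : ℕ} (ψ : schematic.BoundedFormula Empty l) : schematic.Formula (Fin l) :=
  ψ.toFormula.relabel (Sum.elim Empty.elim id)

lemma holdsFormula_ofBound {l : ℕ} (ψ : schematic.BoundedFormula Empty l) (x : Fin l → M) :
    HoldsFormula r (ofBound ψ) x ↔ Holds r ψ x := by
  let := relStructure r
  change (ψ.toFormula.relabel _).Realize x ↔ _
  rw [Formula.realize_relabel, BoundedFormula.realize_toFormula]
  exact iff_of_eq (congrArg₂ (fun w x => BoundedFormula.Realize ψ w x) (Subsingleton.elim _ _) rfl)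

/-- The atomic formula `X^l_c (y_0, …, y_{l - 1})`. -/
def fullAtom (l c : ℕ) : schematic.Formula (Fin l) :=
  BoundedFormula.rel (L := schematic) (l := l) c fun i => .var (.inl i)

lemma mem_freeVarFinset_fullAtom (l c : ℕ) (j : Fin l) : j ∈ (fullAtom l c).freeVarFinset := by
  simp [fullAtom, BoundedFormula.freeVarFinset, Term.varFinsetLeft]

lemma holdsFormula_fullAtom (l c : ℕ) (x : Fin l → M) : HoldsFormula r (fullAtom l c) x ↔ r l c x :=
  Iff.rfl

end Holds

/-! ### Reading off a theory from a coherent diagram -/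

namespace Coherent

variable {X : Place → Bool}

lemma code_iff (hX : Coherent X) (b : Bool) (m n : ℕ) : X (pCode b m n) = true ↔ IsCode b m n := by
  induction m using Nat.strong_induction_on generalizing n with
  | _ m ih =>
    obtain ⟨t, r, rfl⟩ : ∃ t r, m = Nat.pair t r := ⟨_, _, (Nat.pair_unpair m).symm⟩
    -- Since the tags 3 and 4 are positive, this makes the codes of immediate subformulas strictly
    -- smaller.
    have hle := Nat.add_le_pair t r
    match t, hle, ih with
    | 0, _, _ =>
      cases r with
      | zero => simp [hX.code_falsum, isCode_falsum]
      | succ r => simp [hX.code_zero_succ, not_isCode_zero_succ]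
    | 1, _, _ =>
      obtain ⟨s, t, rfl⟩ : ∃ s t, r = Nat.pair s t := ⟨_, _, (Nat.pair_unpair r).symm⟩
      rw [hX.code_equal, isCode_equal, decide_eq_true_iff]
    | 2, _, _ =>
      obtain ⟨s, t, rfl⟩ : ∃ s t, r = Nat.pair s t := ⟨_, _, (Nat.pair_unpair r).symm⟩
      obtain ⟨l, c, rfl⟩ : ∃ l c, s = Nat.pair l c := ⟨_, _, (Nat.pair_unpair s).symm⟩
      obtain ⟨U, rfl⟩ : ∃ U : List ℕ, t = Encodable.encode U :=
        ⟨Denumerable.ofNat (List ℕ) t, (Denumerable.encode_ofNat t).symm⟩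
      rw [hX.code_rel, isCode_rel, decide_eq_true_iff]
    | 3, hle, ih =>
      obtain ⟨s, t, rfl⟩ : ∃ s t, r = Nat.pair s t := ⟨_, _, (Nat.pair_unpair r).symm⟩
      have := Nat.left_le_pair s t
      have := Nat.right_le_pair s t
      rw [hX.code_imp, Bool.and_eq_true, ih s (by omega), ih t (by omega), isCode_imp]
    | 4, hle, ih => rw [hX.code_all, ih r (by omega), isCode_all]
    | t + 5, _, _ => simp [hX.code_add_five, not_isCode_add_five]

/-- The relations on the natural numbers that a diagram describes. -/
def _root_.Validities.diagramRel (X : Place → Bool) (l c : ℕ) (x : Fin l → ℕ) : Prop :=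
  X (pRel c (List.ofFn x)) = true

lemma code_formula (hX : Coherent X) {n : ℕ} (φ : schematic.BoundedFormula Empty n) :
    X (pCode true (schematicEffective.formulaCode φ) n) = true :=
  (hX.code_iff _ _ _).2 ⟨φ, .inl rfl, rfl⟩

lemma _root_.Validities.ofFn_snoc {n : ℕ} {M : Type} (v : Fin n → M) (x : M) :
    List.ofFn (Fin.snoc v x : Fin (n + 1) → M) = List.ofFn v ++ [x] := by
  rw [List.ofFn_succ']
  simp

lemma _root_.Validities.atomCode_ofFn {n l : ℕ} (c : ℕ) (f : Fin l → Fin n) :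
    atomCode c (List.ofFn fun i => (f i : ℕ)) = schematicEffective.formulaCode (atom c f) := by
  rw [formulaCode_atom, atomCode, List.length_ofFn, List.map_ofFn]
  rfl

lemma _root_.Validities.entries_ofFn {n l : ℕ} (v : Fin n → ℕ) (f : Fin l → Fin n) :
    entries (List.ofFn v) (List.ofFn fun i => (f i : ℕ)) = List.ofFn (v ∘ f) := by
  rw [entries, List.map_ofFn]
  congr 1
  funext i
  simp

/-- The satisfaction part of a coherent diagram is correct if it is for atomic formulas. -/
lemma sat_iff_holds (hX : Coherent X) {p : ℕ ⊕ List ℕ} {r : ∀ l : ℕ, ℕ → (Fin l → ℕ) → Prop}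
    (hr : ∀ (n l c : ℕ) (f : Fin l → Fin n) (v : Fin n → ℕ),
      X (pSat (schematicEffective.formulaCode (atom c f)) (List.ofFn v) p) = true ↔ r l c (v ∘ f))
    {n : ℕ} (φ : schematic.BoundedFormula Empty n) (v : Fin n → ℕ) :
    X (pSat (schematicEffective.formulaCode φ) (List.ofFn v) p) = true ↔ Holds r φ v := by
  induction φ using schematic_induction with
  | falsum n =>
    have := hX.sat_falsum (List.ofFn v) p
    simpa [EffectiveLanguage.formulaCode, this] using holds_falsum
  | equal n i j =>
    rw [formulaCode_equal, hX.sat_equal, holds_equal, decide_eq_true_iff]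
    simp
  | atom n l c f => rw [hr, holds_atom]
  | imp n φ ψ ih ih' =>
    have h := hX.sat_imp (schematicEffective.formulaCode φ) (schematicEffective.formulaCode ψ)
      (List.ofFn v) p
    rw [List.length_ofFn, hX.code_formula, hX.code_formula] at h
    rw [formulaCode_imp, holds_imp, ← ih, ← ih', h.resolve_left (by simp) |>.resolve_left (by simp)]
    cases X (pSat (schematicEffective.formulaCode φ) (List.ofFn v) p) <;> simp
  | all n φ ih =>
    rw [formulaCode_all, holds_all]
    have hc := hX.code_formula φ
    constructor
    · intro h x
      have h' := hX.sat_all (schematicEffective.formulaCode φ) (List.ofFn v) p x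
      rw [List.length_ofFn, hc, h, ← ofFn_snoc, ih] at h'
      simpa using h'
    · intro h
      have h' := hX.sat_witness (schematicEffective.formulaCode φ) (List.ofFn v) p
      rw [List.length_ofFn, hc] at h'
      rcases h' with h' | h' | ⟨x, -, hx⟩
      · simp at h'
      · exact h'
      · rw [← ofFn_snoc] at hx
        have := (ih (Fin.snoc v x)).2 (h x)
        rw [hx] at this
        simp at this

lemma sat_shift (hX : Coherent X) (e : ℕ) {n : ℕ} (φ : schematic.BoundedFormula Empty n) (v : Fin n → ℕ) :
    X (pSat (schematicEffective.formulaCode φ) (List.ofFn v) (.inl e)) = true ↔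
      Holds (fun l c x => diagramRel X l (shift e c) x) φ v := by
  refine hX.sat_iff_holds (fun n l c f v => ?_) φ v
  have h := hX.sat_atom_shift c (List.ofFn fun i => (f i : ℕ)) (List.ofFn v) e
  rw [atomCode_ofFn, entries_ofFn, List.length_ofFn, hX.code_formula] at h
  rw [h.resolve_left (by simp), diagramRel]

lemma sat_base (hX : Coherent X) {n : ℕ} (φ : schematic.BoundedFormula Empty n) (v : Fin n → ℕ) :
    X (pSat (schematicEffective.formulaCode φ) (List.ofFn v) (.inl 0)) = true ↔
      Holds (diagramRel X) φ v :=
  hX.sat_shift 0 φ v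

lemma sat_subst (hX : Coherent X) (ps : List ℕ) {n : ℕ} (φ : schematic.BoundedFormula Empty n) (v : Fin n → ℕ) :
    X (pSat (schematicEffective.formulaCode φ) (List.ofFn v) (.inr ps)) = true ↔
      Holds (fun l c x => X (pSat (ps.getD (Nat.pair l c) 0) (List.ofFn x) (.inl 0)) = true) φ v := by
  refine hX.sat_iff_holds (fun n l c f v => ?_) φ v
  have h := hX.sat_atom_subst c (List.ofFn fun i => (f i : ℕ)) (List.ofFn v) ps
  rw [atomCode_ofFn, entries_ofFn, List.length_ofFn, List.length_ofFn, hX.code_formula] at h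
  rw [h.resolve_left (by simp)]

/-- The theory of the structure that a diagram describes. -/
def _root_.Validities.diagramTheory (X : Place → Bool) : schematic.Theory :=
  letI := relStructure (diagramRel X)
  schematic.completeTheory ℕ

lemma _root_.Validities.mem_diagramTheory {σ : schematic.Sentence} :
    σ ∈ diagramTheory X ↔ Holds (diagramRel X) σ default :=
  iff_of_eq (congrArg (Holds (diagramRel X) σ) (Subsingleton.elim _ _))

lemma sat_sentence (hX : Coherent X) (e : ℕ) (σ : schematic.Sentence) :
    X (pSat (schematicEffective.formulaCode σ) [] (.inl e)) = true ↔
      Holds (fun l c x => diagramRel X l (shift e c) x) σ default := by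
  rw [← hX.sat_shift e σ default]
  rfl

/-- The condition `sat_code` excludes numbers marked true that code no sentence. -/
theorem codes_diagramTheory (hX : Coherent X) :
    schematicEffective.codes (diagramTheory X) = {m | X (pSat m [] (.inl 0)) = true} := by
  ext m
  constructor
  · rintro ⟨σ, hσ, rfl⟩
    exact (hX.sat_sentence 0 σ).2 (mem_diagramTheory.1 hσ)
  · intro hm
    have h := hX.sat_code m
    have hm' : X (pSat m [] (.inl 0)) = true := hm
    rw [hm'] at h
    obtain ⟨σ, -, rfl⟩ := (hX.code_iff _ _ _).1 (h.resolve_left (by simp))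
    exact ⟨σ, mem_diagramTheory.2 ((hX.sat_sentence 0 σ).1 hm), rfl⟩

/-- A validity has in particular a true prescribed instance, obtained by substituting atomic
formulas that contain all their variables, so `val_of_sat` forces its mark. Conversely `val_inst`
makes true every instance given by a finite list of formulas, and finitely many symbols are all that
a sentence involves. -/
theorem codes_validities (hX : Coherent X) :
    schematicEffective.codes (validities (diagramTheory X)) = {m | X (pVal m) = true} := by
  ext m
  constructor
  · rintro ⟨φ, ⟨hφ, hinst⟩, rfl⟩
    have hm := hinst (fun l i => fullAtom l (Nat.pair (schematicEffective.formulaCode φ + 1) i))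
      fun l i j => mem_freeVarFinset_fullAtom l _ j
    rw [mem_diagramTheory, holds_substitute] at hm
    have hc : X (pCode false (schematicEffective.formulaCode φ) 0) = true :=
      (hX.code_iff _ _ _).2 ⟨φ, .inr hφ, rfl⟩
    have h := hX.val_of_sat (schematicEffective.formulaCode φ)
    rw [hc, (hX.sat_sentence _ φ).2] at h
    · simpa using h
    · simp only [holdsFormula_fullAtom] at hm
      simpa only [shift, Nat.succ_ne_zero, if_false] using hm
  · intro hm
    have hm' : X (pVal m) = true := hm
    have h := hX.val_code m
    rw [hm'] at h
    obtain ⟨φ, hφ, rfl⟩ := (hX.code_iff _ _ _).1 (h.resolve_left (by simp))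
    refine ⟨φ, ⟨hφ.resolve_left (by simp), fun ψ _ => ?_⟩, rfl⟩
    rw [mem_diagramTheory, holds_substitute]
    -- A symbol occurring in `φ` has arity and index whose pair is at most the code of `φ`, so a
    -- list of this length covers every such symbol.
    let ps := (List.range (schematicEffective.formulaCode φ + 1)).map fun k =>
      schematicEffective.formulaCode (toBound (ψ k.unpair.1 k.unpair.2))
    have h' := hX.val_inst (schematicEffective.formulaCode φ) ps
    rw [hm'] at h'
    have h'' := (hX.sat_subst ps φ default).1 (h'.resolve_left (by simp))
    refine (holds_congr (fun l c hlc => ?_) φ (Nat.lt_succ_self _)).1 h''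
    funext x
    have hps : ps.getD (Nat.pair l c) 0 = schematicEffective.formulaCode (toBound (ψ l c)) := by
      have h : ∀ q : ℕ × ℕ, q = (l, c) → schematicEffective.formulaCode (toBound (ψ q.1 q.2)) =
          schematicEffective.formulaCode (toBound (ψ l c)) := by
        rintro _ rfl
        rfl
      simp only [ps, List.getD_eq_getElem?_getD, List.getElem?_map, List.getElem?_range hlc]
      exact h _ (Nat.unpair_pair l c)
    rw [hps, ← holds_toBound, ← hX.sat_base]

end Coherent

/-! ### The theory is complete and not categorical -/

section Categoricity

universe w

lemma isCompleteTheory_completeTheory (L : FirstOrder.Language.{0, 0}) (M : Type) [L.Structure M]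
    [Nonempty M] : IsCompleteTheory (L.completeTheory M) := by
  refine ⟨fun φ hφ => ?_, completeTheory.isComplete L M⟩
  exact hφ.realize_sentence M

/-- A structure on the natural numbers in which every finite pattern of countably many unary
predicates occurs has a theory that is not categorical in the countable cardinality. -/
theorem not_categorical_of_patterns [schematic.Structure ℕ] (R : ℕ → schematic.Relations 1)
    (hR : ∀ i k, Structure.RelMap (R i) ![2 * k] ↔ k.testBit i = true) :
    ¬ Cardinal.Categorical Cardinal.aleph0.{w} (schematic.completeTheory ℕ) := by
  intro hcat
  let u : Ultrafilter ℕ := Filter.hyperfilter ℕ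
  let N : Type := (u : Filter ℕ).Product fun _ => ℕ
  have hNT : N ⊨ schematic.completeTheory ℕ := by
    refine (Theory.model_iff _).2 fun φ hφ => ?_
    exact (Ultraproduct.sentence_realize φ).2 (Filter.Eventually.of_forall fun _ => hφ)
  -- In the ultrapower the class of the sequence whose `s`-th term is twice a number agreeing with
  -- `A` on its first `s` digits realises the full pattern `A`.
  have hex : ∀ A : ℕ → Bool, ∃ x : N, ∀ i, Structure.RelMap (R i) ![x] ↔ A i = true := by
    intro A
    choose r _ hr using fun s => exists_testBit_eq A s
    let f : ℕ → ℕ := fun n => 2 * r n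
    let y : N := ((f : ∀ _ : ℕ, ℕ) : (u : Filter ℕ).Product fun _ => ℕ)
    refine ⟨y, fun i => ?_⟩
    have h1 : Structure.RelMap (R i) ![y] ↔
        ∀ᶠ n in u, Structure.RelMap (R i) ![f n] := by
      have h := Ultraproduct.realize_formula_cast (u := u) (M := fun _ => ℕ)
        (BoundedFormula.rel (R i) (fun j => .var (.inl j)) : schematic.Formula (Fin 1)) (fun _ => f)
      have e : ∀ {K : Type} [schematic.Structure K] (a : K),
          Formula.Realize (BoundedFormula.rel (R i) (fun j => .var (.inl j)) :
            schematic.Formula (Fin 1)) (fun _ => a) ↔ Structure.RelMap (R i) ![a] := by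
        intro K _ a
        have : (![a] : Fin 1 → K) = fun _ => a := by
          funext j
          fin_cases j
          rfl
        rw [this]
        rfl
      exact (e (K := N) _).symm.trans (h.trans (by simp only [e]))
    rw [h1]
    simp only [f, hR]
    have hev : ∀ᶠ n in u, (r n).testBit i = A i := by
      have : ∀ᶠ n in Filter.atTop, (r n).testBit i = A i :=
        (Filter.eventually_gt_atTop i).mono fun n hn => hr n i hn
      rw [← Nat.cofinite_eq_atTop] at this
      exact Filter.hyperfilter_le_cofinite this
    rw [Filter.eventually_congr (hev.mono fun n hn => by rw [hn])]
    exact Filter.eventually_const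
  choose x hx using hex
  have hxinj : Function.Injective x := fun A B h => funext fun i => by
    rw [Bool.eq_iff_iff, ← hx, ← hx, h]
  have hN : Cardinal.aleph0 ≤ Cardinal.mk N := by
    have : Infinite N := Infinite.of_injective x hxinj
    exact Cardinal.aleph0_le_mk N
  have hL : schematic.card ≤ Cardinal.aleph0 := by
    have : Countable schematic.Symbols := by
      have : ∀ l, Countable (schematic.Functions l) := fun l => inferInstanceAs (Countable Empty)
      have : ∀ l, Countable (schematic.Relations l) := fun l => inferInstanceAs (Countable ℕ)
      exact inferInstanceAs (Countable ((Σ l, schematic.Functions l) ⊕ Σ l, schematic.Relations l))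
    exact Cardinal.mk_le_aleph0
  -- Löwenheim–Skolem puts an element with pattern `A` into a countable elementary substructure.
  -- Categoricity carries it to a number with the same pattern, so the numbers would realise all
  -- subsets of ℕ, against Cantor.
  have hsurj : Function.Surjective fun (k : ℕ) => {i | Structure.RelMap (R i) ![k]} := by
    intro A
    classical
    let A' : ℕ → Bool := fun i => decide (i ∈ A)
    obtain ⟨S, hS, hcard⟩ := exists_elementarySubstructure_card_eq schematic
      ({x A'} : Set N) Cardinal.aleph0.{0} le_rfl (by simp) (by simpa using hL) (by simpa using hN)
    let a : S := ⟨x A', hS rfl⟩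
    obtain ⟨e⟩ := hcat (Theory.ModelType.ulift.{0, 0, 0, w} (.of _ S))
      (Theory.ModelType.ulift.{0, 0, 0, w} (.of _ ℕ))
      (by
        change Cardinal.mk (ULift.{w} S) = _
        rw [Cardinal.lift_id, Cardinal.lift_id] at hcard
        rw [Cardinal.mk_uLift, hcard, Cardinal.lift_aleph0])
      (by
        change Cardinal.mk (ULift.{w} ℕ) = _
        simp)
    let e₁ : S ≃[schematic] Theory.ModelType.ulift.{0, 0, 0, w} (.of (schematic.completeTheory ℕ) S) :=
      Equiv.inducedStructureEquiv Equiv.ulift.symm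
    let e₂ : ℕ ≃[schematic] Theory.ModelType.ulift.{0, 0, 0, w} (.of (schematic.completeTheory ℕ) ℕ) :=
      Equiv.inducedStructureEquiv Equiv.ulift.symm
    let e' : S ≃[schematic] ℕ := (e₂.symm.comp e).comp e₁
    refine ⟨e' a, Set.ext fun i => ?_⟩
    have h1 := e'.map_rel (R i) ![a]
    have h2 : e' ∘ ![a] = ![e' a] := by
      funext j
      fin_cases j
      rfl
    rw [h2] at h1
    have h3 : Structure.RelMap (R i) ![a] ↔ Structure.RelMap (R i) ![x A'] := by
      have h := S.subtype.map_rel (R i) ![a]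
      have h4 : S.subtype ∘ ![a] = ![x A'] := by
        funext j
        fin_cases j
        rfl
      rw [h4] at h
      exact h.symm
    rw [Set.mem_ofPred_eq, h1, h3, hx]
    simp [A']
  exact Function.cantor_surjective _ hsurj

end Categoricity

/-! ### A limit of finite structures -/

section FiniteStructures

/-- Identity-free formulas are preserved under surjective maps that preserve and reflect the
relations. -/
lemma holds_comp_of_surjective {M M' : Type} {r : ∀ l : ℕ, ℕ → (Fin l → M) → Prop}
    {r' : ∀ l : ℕ, ℕ → (Fin l → M') → Prop} {g : M → M'} (hg : Function.Surjective g)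
    (hr : ∀ l c x, r l c x ↔ r' l c (g ∘ x)) {n : ℕ} (φ : schematic.BoundedFormula Empty n)
    (hφ : EqualityFree φ) (v : Fin n → M) : Holds r φ v ↔ Holds r' φ (g ∘ v) := by
  induction φ using schematic_induction with
  | falsum => exact Iff.rfl
  | equal => exact hφ.elim
  | atom n l c f => rw [holds_atom, holds_atom, hr]; rfl
  | imp n φ ψ ih ih' => rw [holds_imp, holds_imp, ih hφ.1, ih' hφ.2]
  | all n φ ih =>
    rw [holds_all, holds_all, hg.forall]
    refine forall_congr' fun x => ?_
    rw [ih hφ, Fin.comp_snoc]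

/-- The sentence is true in all finite structures. -/
def FinValid (φ : schematic.Sentence) : Prop :=
  ∀ (n : ℕ) (r : ∀ l : ℕ, ℕ → (Fin l → Fin (n + 1)) → Prop), Holds r φ default

/-- The relations of a finite structure. -/
structure FinRel where
  size : ℕ
  rel : ∀ l : ℕ, ℕ → (Fin l → Fin (size + 1)) → Prop

lemma exists_counterRel (e : ℕ) : ∃ F : FinRel, ∀ φ : schematic.Sentence,
    schematicEffective.formulaCode φ = e → ¬ FinValid φ → ¬ Holds F.rel φ default := by
  by_cases h : ∃ φ : schematic.Sentence, schematicEffective.formulaCode φ = e ∧ ¬ FinValid φ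
  · obtain ⟨φ, rfl, hφ⟩ := h
    simp only [FinValid, not_forall] at hφ
    obtain ⟨n, r, hr⟩ := hφ
    refine ⟨⟨n, r⟩, fun ψ hψ _ => ?_⟩
    obtain rfl := formulaCode_injective _ hψ
    exact hr
  · exact ⟨⟨0, fun _ _ _ => True⟩, fun φ hφ hφ' => absurd ⟨φ, hφ, hφ'⟩ h⟩

/-- A finite structure that refutes the sentence with the given code if one does. -/
noncomputable def counterRel (e : ℕ) : FinRel := (exists_counterRel e).choose

/-- The retraction of the natural numbers to an initial segment. -/
def clip (n x : ℕ) : Fin (n + 1) := ⟨min x n, by omega⟩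

/-- The relations on `{0, …, k}`: the digits of the elements and the blow-ups of the structures
`counterRel e`. -/
def finRel (k l c : ℕ) (x : Fin l → Fin (k + 1)) : Prop :=
  if c.unpair.1 = 0 then ∀ j, (x j).val.unpair.1.testBit c.unpair.2 = true
  else (counterRel (c.unpair.1 - 1)).rel l c.unpair.2 fun j => clip _ (x j)

lemma finRel_zero (k l i : ℕ) (x : Fin l → Fin (k + 1)) :
    finRel k l (Nat.pair 0 i) x ↔ ∀ j, (x j).val.unpair.1.testBit i = true := by
  simp [finRel]

lemma finRel_succ (k l e i : ℕ) (x : Fin l → Fin (k + 1)) :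
    finRel k l (Nat.pair (e + 1) i) x ↔ (counterRel e).rel l i fun j => clip _ (x j) := by
  -- The size of the target of `clip` depends on the unpaired index, so the pair is generalised
  -- before the equation is used.
  have key : ∀ q : ℕ × ℕ, q = (e + 1, i) →
      ((if q.1 = 0 then ∀ j, (x j).val.unpair.1.testBit q.2 = true
        else (counterRel (q.1 - 1)).rel l q.2 fun j => clip _ (x j)) ↔
      (counterRel e).rel l i fun j => clip _ (x j)) := by
    rintro _ rfl
    exact Iff.rfl
  exact key _ (Nat.unpair_pair _ _)

/-- Once `k` is at least the size of the counterexample, clipping maps {0, …, k} onto it and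
reflects all relations, so identity-free sentences keep their truth values. -/
lemma not_holds_finRel {φ : schematic.Sentence} (hφ : EqualityFree φ) (hφ' : ¬ FinValid φ) {k : ℕ}
    (hk : (counterRel (schematicEffective.formulaCode φ)).size ≤ k) :
    ¬ Holds (fun l c x => finRel k l (Nat.pair (schematicEffective.formulaCode φ + 1) c) x) φ
      default := by
  set F := counterRel (schematicEffective.formulaCode φ) with hF
  have hg : Function.Surjective fun x : Fin (k + 1) => clip F.size x := fun y =>
    ⟨⟨y, by omega⟩, Fin.ext (by simp [clip]; omega)⟩
  rw [holds_comp_of_surjective (r' := F.rel) hg (fun l c x => finRel_succ _ _ _ _ _) φ hφ]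
  rw [Subsingleton.elim (_ ∘ _) default]
  exact (exists_counterRel _).choose_spec φ rfl hφ'

/-- There is an infinite structure in which the definable structures satisfy all sentences true in
finite structures, the other identity-free sentences being refuted uniformly. -/
theorem exists_limit_structure : ∃ (N : Type) (r : ∀ l : ℕ, ℕ → (Fin l → N) → Prop),
    (∀ φ : schematic.Sentence, FinValid φ → ∀ ψ : ∀ l : ℕ, ℕ → schematic.Formula (Fin l),
      Holds r (substitute ψ φ) default) ∧
    (∀ φ : schematic.Sentence, EqualityFree φ → ¬ FinValid φ →
      ¬ Holds (fun l c x => r l (Nat.pair (schematicEffective.formulaCode φ + 1) c) x) φ default) ∧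
    ∀ k : ℕ, {x : N | ∀ i, r 1 (Nat.pair 0 i) (fun _ => x) ↔ k.testBit i = true}.Infinite := by
  let u : Ultrafilter ℕ := Filter.hyperfilter ℕ
  let inst : ∀ k : ℕ, schematic.Structure (Fin (k + 1)) := fun k => relStructure (finRel k)
  let N : Type := (u : Filter ℕ).Product fun k => Fin (k + 1)
  let S : schematic.Structure N := Ultraproduct.structure
  let r : ∀ l : ℕ, ℕ → (Fin l → N) → Prop := fun l c x => S.RelMap (n := l) c x
  have hS : relStructure r = S := by
    refine Structure.ext ?_ rfl
    funext n f
    exact f.elim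
  have hN : ∀ (φ : schematic.Sentence) (v : Fin 0 → N),
      Holds r φ v ↔ ∀ᶠ k in u, Holds (finRel k) φ default := by
    intro φ v
    have h := Ultraproduct.sentence_realize (u := u) (M := fun k => Fin (k + 1)) φ
    have h1 : Holds r φ v ↔ N ⊨ φ := by
      rw [Holds, hS]
      exact iff_of_eq (congrArg (BoundedFormula.Realize φ _) (Subsingleton.elim _ _))
    have h2 : ∀ k, Holds (finRel k) φ default ↔ Fin (k + 1) ⊨ φ := fun k =>
      iff_of_eq (congrArg (Holds (finRel k) φ) (Subsingleton.elim _ _))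
    rw [h1, h]
    simp only [h2]
  have hlarge : ∀ m : ℕ, ∀ᶠ k in u, m ≤ k := fun m => by
    have := Filter.eventually_ge_atTop (α := ℕ) m
    rw [← Nat.cofinite_eq_atTop] at this
    exact Filter.hyperfilter_le_cofinite this
  refine ⟨N, r, fun φ hφ ψ => ?_, fun φ hφ hφ' => ?_, fun k => ?_⟩
  -- At each stage the substituted formulas define relations on a finite set, that is, another
  -- finite structure, where `φ` holds.
  · rw [hN]
    refine Filter.Eventually.of_forall fun k => ?_
    rw [holds_substitute]
    exact hφ k _
  · have h := holds_substitute (r := r) (v := (Unique.instInhabited.default : Fin 0 → N))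
      (fun l c => fullAtom l (Nat.pair (schematicEffective.formulaCode φ + 1) c)) φ
    simp only [holdsFormula_fullAtom] at h
    refine (not_congr h).1 ?_
    rw [hN, ← Ultrafilter.eventually_not]
    refine (hlarge (counterRel (schematicEffective.formulaCode φ)).size).mono fun k hk => ?_
    have h' := holds_substitute (r := finRel k) (v := default)
      (fun l c => fullAtom l (Nat.pair (schematicEffective.formulaCode φ + 1) c)) φ
    simp only [holdsFormula_fullAtom] at h'
    rw [h']
    exact not_holds_finRel hφ hφ' hk
  -- The digits are read from the first component of a pair, so varying the second gives infinitely
  -- many elements with the pattern of `k`; clipping is harmless at large stages.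
  · let f : ℕ → ∀ n : ℕ, Fin (n + 1) := fun j n => clip n (Nat.pair k j)
    let y : ℕ → N := fun j => ((f j : ∀ n : ℕ, Fin (n + 1)) :
      (u : Filter ℕ).Product fun n => Fin (n + 1))
    have hf : ∀ j, ∀ᶠ n in u, (f j n).val = Nat.pair k j := fun j =>
      (hlarge (Nat.pair k j)).mono fun n hn => by simp [f, clip, hn]
    refine Set.infinite_of_injective_forall_mem (f := y) (fun j j' h => ?_) fun j i => ?_
    · have h' : ∀ᶠ n in u, f j n = f j' n := Quotient.eq''.1 h
      obtain ⟨n, h1, h2, h3⟩ := (h'.and ((hf j).and (hf j'))).exists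
      rw [h1, h3] at h2
      exact ((Nat.pair_eq_pair.1 h2).2).symm
    · have h : r 1 (Nat.pair 0 i) (fun _ => y j) ↔
          ∀ᶠ n in u, finRel n 1 (Nat.pair 0 i) fun _ => f j n := by
        have h := Ultraproduct.realize_formula_cast (u := u) (M := fun k => Fin (k + 1))
          (fullAtom 1 (Nat.pair 0 i)) (fun _ => f j)
        exact h
      rw [h]
      have hev := (hf j).mono fun n hn =>
        show (finRel n 1 (Nat.pair 0 i) fun _ => f j n) ↔ k.testBit i = true by
          rw [finRel_zero]
          simp [hn]
      rw [Filter.eventually_congr hev]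
      exact Filter.eventually_const

end FiniteStructures

/-! ### Naming elements by natural numbers -/

section Naming

/-- Elements of a set can be named by natural numbers without repetition so that the even names are
given to elements of prescribed infinite sets, and the odd names to witnesses where they are
needed. -/
theorem exists_naming {N : Type} {E : ℕ → Set N} (hE : ∀ k, (E k).Infinite)
    (B : ℕ → List N → Set N) :
    ∃ h : ℕ → N, Function.Injective h ∧ (∀ k, h (2 * k) ∈ E k) ∧
      ∀ j, (B j ((List.range (2 * j + 1)).map h)).Nonempty →
        ∃ x < 2 * j + 2, h x ∈ B j ((List.range (2 * j + 1)).map h) := by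
  classical
  have fresh : ∀ (k : ℕ) (prev : List N), ∃ y ∈ E k, y ∉ prev := fun k prev => by
    obtain ⟨y, hy, hy'⟩ := (hE k).exists_notMem_finset prev.toFinset
    exact ⟨y, hy, by simpa using hy'⟩
  have hstep : ∀ (n : ℕ) (prev : List N), ∃ y, y ∉ prev ∧ (∀ k, n = 2 * k → y ∈ E k) ∧
      ∀ j, n = 2 * j + 1 → (∃ z ∈ B j prev, z ∉ prev) → y ∈ B j prev := by
    intro n prev
    rcases Nat.even_or_odd' n with ⟨k, rfl | rfl⟩
    · obtain ⟨y, hy, hy'⟩ := fresh k prev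
      refine ⟨y, hy', fun k' hk' => ?_, fun j hj => by omega⟩
      obtain rfl : k = k' := by omega
      exact hy
    -- The odd name goes to a new witness if there is one. Otherwise every witness is already named,
    -- and any fresh element will do.
    · by_cases hz : ∃ z ∈ B k prev, z ∉ prev
      · obtain ⟨z, hz, hz'⟩ := hz
        refine ⟨z, hz', fun k' hk' => by omega, fun j hj _ => ?_⟩
        obtain rfl : k = j := by omega
        exact hz
      · obtain ⟨y, -, hy'⟩ := fresh 0 prev
        refine ⟨y, hy', fun k' hk' => by omega, fun j hj h => ?_⟩
        obtain rfl : k = j := by omega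
        exact absurd h hz
  choose step hfresh heven hodd using hstep
  let g : ℕ → List N := fun n => n.rec [] fun n prev => prev ++ [step n prev]
  let h : ℕ → N := fun n => step n (g n)
  have hg : ∀ n, g n = (List.range n).map h := by
    intro n
    induction n with
    | zero => rfl
    | succ n ih =>
      rw [List.range_succ, List.map_append, ← ih]
      rfl
  have hmem : ∀ n y, y ∈ g n ↔ ∃ i < n, h i = y := fun n y => by simp [hg]
  refine ⟨h, ?_, fun k => heven _ _ k rfl, fun j hj => ?_⟩
  · have hlt : ∀ i n, i < n → h i ≠ h n := fun i n hin hne =>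
      hfresh n (g n) ((hmem _ _).2 ⟨i, hin, hne⟩)
    intro i n hin
    rcases lt_trichotomy i n with hlt' | rfl | hlt'
    · exact absurd hin (hlt _ _ hlt')
    · rfl
    · exact absurd hin.symm (hlt _ _ hlt')
  · rw [← hg] at hj ⊢
    obtain ⟨z, hz⟩ := hj
    by_cases hz' : z ∈ g (2 * j + 1)
    · obtain ⟨i, hi, rfl⟩ := (hmem (2 * j + 1) z).1 hz'
      exact ⟨i, by omega, hz⟩
    · exact ⟨2 * j + 1, by omega, hodd _ _ j rfl ⟨z, hz, hz'⟩⟩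

end Naming

/-! ### A coherent diagram -/

section Existence

variable {N : Type} (r : ∀ l : ℕ, ℕ → (Fin l → N) → Prop)

/-- The relations that interpret the relation symbols according to the parameter of a place. -/
def interp : ℕ ⊕ List ℕ → ∀ l : ℕ, ℕ → (Fin l → N) → Prop
  | .inl e => fun l c x => r l (shift e c) x
  | .inr ps => fun l c x => ∃ χ : schematic.BoundedFormula Empty l,
      schematicEffective.formulaCode χ = ps.getD (Nat.pair l c) 0 ∧ Holds r χ x

/-- The number is the code of a formula that is true at the listed elements. -/
def SatList (m : ℕ) (xs : List N) (p : ℕ ⊕ List ℕ) : Prop :=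
  ∃ (n : ℕ) (w : Fin n → N) (φ : schematic.BoundedFormula Empty n), xs = List.ofFn w ∧
    schematicEffective.formulaCode φ = m ∧ Holds (interp r p) φ w

/-- The listed elements are in the relation named by the symbol. -/
def RelList (c : ℕ) (xs : List N) : Prop :=
  ∃ (n : ℕ) (w : Fin n → N), xs = List.ofFn w ∧ r n c w

variable {r} {n : ℕ}

lemma satList_iff {p : ℕ ⊕ List ℕ} (φ : schematic.BoundedFormula Empty n) (w : Fin n → N) :
    SatList r (schematicEffective.formulaCode φ) (List.ofFn w) p ↔ Holds (interp r p) φ w := by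
  constructor
  · rintro ⟨n', w', φ', hw, hφ, h⟩
    obtain rfl : n = n' := by simpa using congrArg List.length hw
    obtain rfl := List.ofFn_injective hw
    obtain rfl := formulaCode_injective _ hφ
    exact h
  · exact fun h => ⟨n, w, φ, rfl, rfl, h⟩

lemma SatList.isCode {m : ℕ} {w : Fin n → N} {p : ℕ ⊕ List ℕ} (h : SatList r m (List.ofFn w) p) :
    IsCode true m n := by
  obtain ⟨n', w', φ', hw, hφ, h⟩ := h
  obtain rfl : n = n' := by simpa using congrArg List.length hw
  exact ⟨φ', .inl rfl, hφ⟩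

lemma relList_iff {c : ℕ} (w : Fin n → N) : RelList r c (List.ofFn w) ↔ r n c w := by
  constructor
  · rintro ⟨n', w', hw, h⟩
    obtain rfl : n = n' := by simpa using congrArg List.length hw
    obtain rfl := List.ofFn_injective hw
    exact h
  · exact fun h => ⟨n, w, rfl, h⟩

lemma isCode_atomCode {b : Bool} {c : ℕ} {is : List ℕ} (h : IsCode b (atomCode c is) n) :
    ∃ (l : ℕ) (f : Fin l → Fin n), is = List.ofFn fun i => (f i : ℕ) := by
  rw [atomCode, isCode_rel] at h
  have h' : ∀ i : Fin is.length, is[i] < n := fun i => by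
    simpa using (h.2 _ (List.mem_map_of_mem (List.getElem_mem i.2))).2
  exact ⟨is.length, fun i => ⟨is[i], h' i⟩, List.ofFn_getElem.symm⟩

lemma le_encode_of_mem {x : ℕ} {v : List ℕ} (hx : x ∈ v) : x ≤ Encodable.encode v := by
  induction v with
  | nil => simp at hx
  | cons a v ih =>
    rw [Encodable.encode_list_cons]
    rcases List.mem_cons.1 hx with rfl | hx
    · exact (Nat.left_le_pair _ _).trans (Nat.le_succ _)
    · exact (ih hx).trans ((Nat.right_le_pair _ _).trans (Nat.le_succ _))

lemma map_ofFn_nat (h : ℕ → N) (v : Fin n → ℕ) : (List.ofFn v).map h = List.ofFn (h ∘ v) := by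
  rw [List.map_ofFn]

variable (r) in
/-- The diagram of a structure with named elements. -/
def diagramProp (h : ℕ → N) : Place → Prop
  | .inl (b, m, n) => IsCode b m n
  | .inr (.inl (c, x)) => RelList r c (x.map h)
  | .inr (.inr (.inl (m, v, p))) => SatList r m (v.map h) p
  | .inr (.inr (.inr m)) => ∃ φ : schematic.Sentence,
      schematicEffective.formulaCode φ = m ∧ EqualityFree φ ∧ FinValid φ

/-- The naming of elements provides witnesses for the definable existential statements. -/
def HasWitnesses (r : ∀ l : ℕ, ℕ → (Fin l → N) → Prop) (h : ℕ → N) : Prop :=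
  ∀ (n : ℕ) (φ : schematic.BoundedFormula Empty (n + 1)) (v : Fin n → ℕ) (p : ℕ ⊕ List ℕ),
    (∃ y, ¬ Holds (interp r p) φ (Fin.snoc (h ∘ v) y)) →
      ∃ x < witnessBound (schematicEffective.formulaCode φ) (List.ofFn v) p,
        ¬ Holds (interp r p) φ (Fin.snoc (h ∘ v) (h x))

-- Truth is pulled back along the names: distinct names make identity of numbers correct, and the
-- marked validities are the identity-free sentences true in all finite structures. Of the
-- conditions on validity, `hval` gives the truth of all instances and `hnval` the failure of the
-- prescribed one.
open Classical in
lemma coherent_diagramProp {h : ℕ → N} (hinj : Function.Injective h)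
    (heven : ∀ k i, r 1 (Nat.pair 0 i) (fun _ => h (2 * k)) ↔ k.testBit i = true)
    (hwit : HasWitnesses r h)
    (hval : ∀ φ : schematic.Sentence, FinValid φ →
      ∀ ψ : ∀ l : ℕ, ℕ → schematic.Formula (Fin l), Holds r (substitute ψ φ) default)
    (hnval : ∀ φ : schematic.Sentence, EqualityFree φ → ¬ FinValid φ →
      ¬ Holds (fun l c x => r l (Nat.pair (schematicEffective.formulaCode φ + 1) c) x) φ default) :
    Coherent fun q => decide (diagramProp r h q) := by
  have hcode : ∀ b m n, decide (diagramProp r h (pCode b m n)) = decide (IsCode b m n) :=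
    fun _ _ _ => rfl
  have hrel : ∀ c x, decide (diagramProp r h (pRel c x)) = decide (RelList r c (x.map h)) :=
    fun _ _ => rfl
  have hsat : ∀ m v p, decide (diagramProp r h (pSat m v p)) = decide (SatList r m (v.map h) p) :=
    fun _ _ _ => rfl
  have hpval : ∀ m, decide (diagramProp r h (pVal m)) = decide (∃ φ : schematic.Sentence,
      schematicEffective.formulaCode φ = m ∧ EqualityFree φ ∧ FinValid φ) := fun _ => rfl
  have hlist : ∀ v : List ℕ, ∃ (n : ℕ) (v' : Fin n → ℕ), v = List.ofFn v' := fun v =>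
    ⟨v.length, v.get, (List.ofFn_get v).symm⟩
  have hnil : ([] : List ℕ).map h = List.ofFn (default : Fin 0 → N) := rfl
  constructor
  · intro b n
    rw [hcode, decide_eq_true_iff]
    exact isCode_falsum
  · intro b r n
    rw [hcode, decide_eq_false_iff_not]
    exact not_isCode_zero_succ
  · intro b s t n
    rw [hcode, decide_eq_decide]
    exact isCode_equal
  · intro b l c U n
    rw [hcode, decide_eq_decide]
    exact isCode_rel
  · intro b a a' n
    rw [hcode, hcode, hcode, ← Bool.decide_and, decide_eq_decide]
    exact isCode_imp
  · intro b a n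
    rw [hcode, hcode, decide_eq_decide]
    exact isCode_all
  · intro b t r n
    rw [hcode, decide_eq_false_iff_not]
    exact not_isCode_add_five
  · intro v p
    obtain ⟨n, v, rfl⟩ := hlist v
    rw [hsat, decide_eq_false_iff_not, map_ofFn_nat]
    exact fun H => holds_falsum ((satList_iff (.falsum) _).1 H)
  · intro i j v p
    obtain ⟨n, v, rfl⟩ := hlist v
    rw [hsat, decide_eq_decide, map_ofFn_nat, List.length_ofFn]
    have key : ∀ i j : Fin n, SatList r (Nat.pair 1 (Nat.pair (Nat.pair 0 i) (Nat.pair 0 j)))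
        (List.ofFn (h ∘ v)) p ↔ v i = v j := fun i j => by
      rw [← formulaCode_equal, satList_iff, holds_equal]
      exact hinj.eq_iff
    constructor
    · intro H
      obtain ⟨-, hi, hj⟩ := isCode_equal.1 H.isCode
      simp only [IsVarCode, Nat.unpair_pair, true_and] at hi hj
      exact ⟨hi, hj, by simpa [hi, hj] using (key ⟨i, hi⟩ ⟨j, hj⟩).1 H⟩
    · rintro ⟨hi, hj, H⟩
      exact (key ⟨i, hi⟩ ⟨j, hj⟩).2 (by simpa [hi, hj] using H)
  · intro c is v e
    obtain ⟨n, v, rfl⟩ := hlist v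
    rw [hcode, List.length_ofFn, decide_eq_false_iff_not, or_iff_not_imp_left, not_not]
    intro H
    obtain ⟨l, f, rfl⟩ := isCode_atomCode H
    rw [hsat, hrel, decide_eq_decide, atomCode_ofFn, entries_ofFn, map_ofFn_nat, map_ofFn_nat,
      satList_iff, relList_iff, holds_atom]
    rfl
  · intro c is v ps
    obtain ⟨n, v, rfl⟩ := hlist v
    rw [hcode, List.length_ofFn, decide_eq_false_iff_not, or_iff_not_imp_left, not_not]
    intro H
    obtain ⟨l, f, rfl⟩ := isCode_atomCode H
    rw [hsat, hsat, decide_eq_decide, atomCode_ofFn, entries_ofFn, map_ofFn_nat, map_ofFn_nat,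
      satList_iff, holds_atom, List.length_ofFn]
    constructor
    · rintro ⟨χ, hχ, H⟩
      rw [← hχ]
      exact (satList_iff χ _).2 H
    · intro H
      obtain ⟨χ, -, hχ⟩ := H.isCode
      rw [← hχ, satList_iff] at H
      exact ⟨χ, hχ, H⟩
  · intro a a' v p
    obtain ⟨n, v, rfl⟩ := hlist v
    rw [hcode, hcode, List.length_ofFn, decide_eq_false_iff_not, decide_eq_false_iff_not,
      or_iff_not_imp_left, not_not, or_iff_not_imp_left, not_not]
    rintro ⟨φ, -, rfl⟩ ⟨ψ, -, rfl⟩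
    rw [hsat, hsat, hsat, ← formulaCode_imp, map_ofFn_nat, ← decide_not, ← Bool.decide_or,
      decide_eq_decide, satList_iff, satList_iff, satList_iff, holds_imp, imp_iff_not_or]
  · intro a v p x
    obtain ⟨n, v, rfl⟩ := hlist v
    rw [hcode, List.length_ofFn, decide_eq_false_iff_not, or_iff_not_imp_left, not_not]
    rintro ⟨φ, -, rfl⟩
    rw [hsat, hsat, ← formulaCode_all, ← ofFn_snoc, map_ofFn_nat, map_ofFn_nat, decide_eq_false_iff_not,
      decide_eq_true_iff, satList_iff, satList_iff, Fin.comp_snoc, ← imp_iff_not_or]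
    exact fun H => H (h x)
  · intro a v p
    obtain ⟨n, v, rfl⟩ := hlist v
    rw [hcode, List.length_ofFn, decide_eq_false_iff_not, or_iff_not_imp_left, not_not]
    rintro ⟨φ, -, rfl⟩
    rw [hsat, ← formulaCode_all, map_ofFn_nat, decide_eq_true_iff, satList_iff, or_iff_not_imp_left,
      holds_all, not_forall]
    intro H
    obtain ⟨x, hx, H⟩ := hwit n φ v p H
    refine ⟨x, hx, ?_⟩
    rwa [hsat, ← ofFn_snoc, map_ofFn_nat, decide_eq_false_iff_not, satList_iff, Fin.comp_snoc]
  · intro i k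
    rw [hrel, Bool.eq_iff_iff, decide_eq_true_iff, ← heven]
    exact relList_iff (n := 1) fun _ => h (2 * k)
  · intro m
    rw [hsat, hcode, decide_eq_false_iff_not, decide_eq_true_iff, ← imp_iff_not_or, hnil]
    exact SatList.isCode
  · intro m
    rw [hpval, hcode, decide_eq_false_iff_not, decide_eq_true_iff, ← imp_iff_not_or]
    rintro ⟨φ, rfl, hφ, -⟩
    exact ⟨φ, .inr hφ, rfl⟩
  · intro m ps
    rw [hpval, hsat, decide_eq_false_iff_not, decide_eq_true_iff, ← imp_iff_not_or, hnil]
    rintro ⟨φ, rfl, -, hφ⟩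
    rw [satList_iff]
    -- An entry that codes no formula in `l` variables names the empty relation, hence falsum.
    let ψ : ∀ l : ℕ, ℕ → schematic.Formula (Fin l) := fun l c =>
      if H : ∃ χ : schematic.BoundedFormula Empty l,
        schematicEffective.formulaCode χ = ps.getD (Nat.pair l c) 0 then ofBound H.choose else ⊥
    have hψ : interp r (.inr ps) = fun l c x => HoldsFormula r (ψ l c) x := by
      funext l c x
      refine propext ?_
      by_cases H : ∃ χ : schematic.BoundedFormula Empty l,
        schematicEffective.formulaCode χ = ps.getD (Nat.pair l c) 0
      · simp only [ψ, dif_pos H, holdsFormula_ofBound]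
        constructor
        · rintro ⟨χ, hχ, hx⟩
          rwa [formulaCode_injective _ (H.choose_spec.trans hχ.symm)]
        · exact fun hx => ⟨_, H.choose_spec, hx⟩
      · simp only [ψ, dif_neg H]
        exact ⟨fun ⟨χ, hχ, _⟩ => H ⟨χ, hχ⟩, fun hx => hx.elim⟩
    rw [hψ, ← holds_substitute]
    exact hval φ hφ ψ
  · intro m
    rw [hpval, hcode, hsat, decide_eq_false_iff_not, decide_eq_true_iff, decide_eq_false_iff_not, hnil]
    by_contra! H
    obtain ⟨H1, ⟨φ, hφ, rfl⟩, H2⟩ := H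
    replace hφ := hφ.resolve_left (by simp)
    refine hnval φ hφ (fun hv => H1 φ rfl hφ hv) ?_
    rw [satList_iff] at H2
    simpa only [interp, shift, Nat.succ_ne_zero, if_false] using H2

theorem exists_coherent : ∃ X : Place → Bool, Coherent X := by
  obtain ⟨N, r, hval, hnval, hinf⟩ := exists_limit_structure
  obtain ⟨d, -⟩ := (hinf 0).nonempty
  -- Stage `j` looks for a counterexample to the universal formula, parameters and interpretation
  -- that `j` codes. The default `d` only makes look-ups in the list total.
  obtain ⟨h, hinj, heven, hodd⟩ := exists_naming hinf fun j prev =>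
    {y | ∃ (n : ℕ) (φ : schematic.BoundedFormula Empty (n + 1)) (v : Fin n → ℕ) (p : ℕ ⊕ List ℕ),
      j = Encodable.encode (schematicEffective.formulaCode φ, List.ofFn v, p) ∧
        ¬ Holds (interp r p) φ (Fin.snoc (fun i => prev.getD (v i) d) y)}
  refine ⟨_, coherent_diagramProp hinj heven ?_ hval hnval⟩
  intro n φ v p hy
  set j := Encodable.encode (schematicEffective.formulaCode φ, List.ofFn v, p) with hj
  -- Parameters are at most the code of the request in which they occur, so they are already named
  -- when it is treated.
  have hv : ∀ i, v i < 2 * j + 1 := fun i => by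
    have h1 : v i ≤ Encodable.encode (List.ofFn v) := le_encode_of_mem (by simp)
    have h2 : Encodable.encode (List.ofFn v) ≤ j := by
      rw [hj, Encodable.encode_prod_val, Encodable.encode_prod_val]
      exact (Nat.left_le_pair _ _).trans (Nat.right_le_pair _ _)
    omega
  have hprev : (fun i => ((List.range (2 * j + 1)).map h).getD (v i) d) = h ∘ v := by
    funext i
    simp [List.getD_eq_getElem?_getD, hv i]
  obtain ⟨x, hx, n', φ', v', p', he, hH⟩ := hodd j (by
    obtain ⟨y, hy⟩ := hy
    exact ⟨y, n, φ, v, p, hj, by rwa [hprev]⟩)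
  have he' := Encodable.encode_injective (hj.symm.trans he)
  simp only [Prod.mk.injEq] at he'
  obtain ⟨he1, he2, rfl⟩ := he'
  obtain rfl : n = n' := by simpa using congrArg List.length he2
  obtain rfl := List.ofFn_injective he2
  obtain rfl := formulaCode_injective _ he1
  exact ⟨x, hx, by rwa [hprev] at hH⟩

end Existence

/-! ### Computability of the theory and of its validities -/

lemma computableInDegree_iff {A U : Set ℕ} :
    ComputableInDegree (degree U) A ↔ TuringReducible (charFun A : ℕ →. ℕ) (charFun U : ℕ →. ℕ) :=
  Iff.rfl

lemma computableInDegree_of_turingReducible {d : TuringDegree} {A U : Set ℕ}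
    (hU : ComputableInDegree d U)
    (hA : TuringReducible (charFun A : ℕ →. ℕ) (charFun U : ℕ →. ℕ)) : ComputableInDegree d A :=
  le_trans (computableInDegree_iff.2 hA) hU

lemma turingReducible_charFun_of_primrec {Y : ℕ → Bool} {g : ℕ →. ℕ} {i : ℕ → ℕ} (hi : Primrec i)
    (hY : TuringReducible (fun n => (Y n).toNat : ℕ → ℕ) g) :
    TuringReducible (charFun {m | Y (i m) = true} : ℕ →. ℕ) g := by
  have h := recursiveIn_comp (RecursiveIn.iff_nat.1 hY) (recursiveIn_primrec hi)
  refine RecursiveIn.iff_nat.2 (h.of_eq fun n => ?_)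
  cases hn : Y (i n) <;> simp [charFun, hn]

/-- A complete extension of Peano arithmetic computes a coherent diagram. -/
theorem exists_coherent_turingReducible {U : arith.Theory} (hPA : PA ⊆ U) (hU : IsCompleteTheory U) :
    ∃ Y : ℕ → Bool, Coherent (fun q => Y (Encodable.encode q)) ∧
      TuringReducible (fun n => (Y n).toNat : ℕ → ℕ) (charFun (arithEffective.codes U) : ℕ →. ℕ) := by
  obtain ⟨cl, hcl, hcoh⟩ := isClauseClass_coherent
  obtain ⟨X, hX⟩ := exists_coherent
  have hcl' : Primrec fun n => (cl n).map fun q => (Encodable.encode q.1, q.2) :=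
    Primrec.list_map hcl ((Primrec.encode.comp (Primrec.fst.comp Primrec.snd)).pair
      (Primrec.snd.comp Primrec.snd)).to₂
  -- The clauses mention only numbers that code places, so the value given to the other numbers is
  -- immaterial.
  obtain ⟨Y, hY, hred⟩ := exists_member_turingReducible hPA hU hcl'
    (X := fun n => (Encodable.decode (α := Place) n).elim false X) (fun n => by
      obtain ⟨q, hq, hXq⟩ := (hcoh X).1 hX n
      exact ⟨_, List.mem_map_of_mem hq, by simpa using hXq⟩)
  refine ⟨Y, (hcoh _).2 fun n => ?_, hred⟩
  obtain ⟨_, hq, h⟩ := hY n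
  obtain ⟨q, hq', rfl⟩ := List.mem_map.1 hq
  exact ⟨q, hq', h⟩

universe w

lemma Coherent.not_categorical {X : Place → Bool} (hX : Coherent X) :
    ¬ Cardinal.Categorical Cardinal.aleph0.{w} (diagramTheory X) := by
  let _ := relStructure (diagramRel X)
  refine not_categorical_of_patterns (fun i => Nat.pair 0 i) fun i k => ?_
  rw [← hX.rel_testBit]
  rfl

lemma exists_infinite_model (X : Place → Bool) :
    ∃ M : (diagramTheory X).ModelType.{0, 0, w}, Infinite M := by
  let _ := relStructure (diagramRel X)
  have : ℕ ⊨ diagramTheory X := inferInstanceAs (ℕ ⊨ schematic.completeTheory ℕ)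
  exact ⟨(Theory.ModelType.of (diagramTheory X) ℕ).ulift,
    inferInstanceAs (Infinite (ULift.{w} ℕ))⟩

end Validities

theorem mainTheorem7 (d : TuringDegree) (hd : Validities.IsPADegree d) :
    ∃ (L : FirstOrder.Language.{0, 0}) (ν : Validities.EffectiveLanguage L) (T : L.Theory),
      Validities.IsCompleteTheory T ∧
      (∃ M : T.ModelType, Infinite M) ∧
      ¬ Cardinal.Categorical Cardinal.aleph0 T ∧
      Validities.ComputableInDegree d (ν.codes T) ∧
      Validities.ComputableInDegree d
        (Validities.schematicEffective.codes (Validities.validities T)) := by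
  obtain ⟨-, U, hPA, hU, hcomp⟩ := hd
  -- From here on only the coherence of the computed diagram is used, not the limit structure that
  -- showed the class to be nonempty.
  obtain ⟨Y, hX, hY⟩ := Validities.exists_coherent_turingReducible hPA hU
  refine ⟨_, Validities.schematicEffective,
    Validities.diagramTheory fun q => Y (Encodable.encode q), ?_,
    Validities.exists_infinite_model _, hX.not_categorical, ?_, ?_⟩
  · let _ := Validities.relStructure (Validities.diagramRel fun q => Y (Encodable.encode q))
    exact Validities.isCompleteTheory_completeTheory _ ℕ
  · rw [hX.codes_diagramTheory]
    exact Validities.computableInDegree_of_turingReducible hcomp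
      (Validities.turingReducible_charFun_of_primrec (Primrec.encode.comp
        (Validities.primrec_pSat Primrec.id (Primrec.const []) (Primrec.const (Sum.inl 0)))) hY)
  · rw [hX.codes_validities]
    exact Validities.computableInDegree_of_turingReducible hcomp
      (Validities.turingReducible_charFun_of_primrec
        (Primrec.encode.comp (Validities.primrec_pVal Primrec.id)) hY)
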